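/- Let $T$ be a commutative ring, $R$ a (unital, associative) $T$-algebra, and $X$ a preordered set in which all intervals $[x,y]=\{z: x\le z\le y\}$ are finite. Let $K=I(X,R)$ be the incidence algebra: all $f\colon X\times X\to R$ with $f(x,y)=0$ whenever $x\not\le y$, with pointwise addition and $T$-action and with $(fg)(x,y)=\sum_{x\le z\le y}f(x,z)g(z,y)$. Write $x\sim y$ if $x\le y\le x$, let $[x]$ be the class of $x$ and $n_x=|[x]|$. Put $L=\{f\in K: f(x,y)=0 \text{ if } x\not\sim y\}$ (a subalgebra) and $M=\{f\in K: f(x,y)=0\text{ if }x\sim y\}$ (an ideal), so that $K=L\oplus M$. Let $e_x\in K$ be $1$ at $(t,t)$ for $t\in[x]$ and $0$ elsewhere, and $R_x=e_xKe_x$, a ring with identity $e_x$; numbering $[x]$ identifies $R_x$ with $M(n_x,R)$, and $L=\prod_{[x]}R_x$. All automorphisms are automorphisms of $T$-algebras. For an algebra $A$, $\mathrm{In}(\mathrm{Aut}\,A)$ is the group of inner automorphisms and $\mathrm{Out}\,A=\mathrm{Aut}\,A/\mathrm{In}(\mathrm{Aut}\,A)$. Groups: - $\Omega\le\mathrm{Aut}\,L$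 consists of those $\alpha$ for which there is $\varphi\in\mathrm{Aut}\,K$ with $\varphi(M)=M$ and $\varphi(a)-\alpha(a)\in M$ for all $a\in L$; $\Omega_1=\{\alpha\in\Omega:\alpha R_x=R_x\text{ for all }x\}$. For $\alpha\in\Omega_1$, $\alpha_x$ is the restriction of $\alpha$ to $R_x$. - $C=\{\varphi\in\mathrm{Aut}\,K:\varphi L=L,\ \varphi M=M,\ \varphi R_x=R_x\text{ for all }x\}$. - $\Psi=\{\varphi\in\mathrm{Aut}\,K:\varphi M=M,\ \varphi|_L=\mathrm{id}\}$. - $\mathrm{In}_0(\mathrm{Aut}\,K)$ is the group of inner automorphisms of $K$ defined by invertible elements of $L$, and $\Psi_0$ is the group of those defined by invertible central elements of $L$. $\mathrm{Out}_0K=C/\mathrm{In}_0(\mathrm{Aut}\,K)$. Let $k$ be a natural number dividing every $n_x$, let $P=M(k,R)$, fix a numbering of each class, and divide each class into consecutive blocks of $k$ elements. Every $\varepsilon\in\mathrm{Aut}\,P$ acts on functions in $K$ by applying $\varepsilon$ to each $k\times k$ block. This is an automorphism of $K$, which restricts to automorphisms of $L$ and of each $R_x$; all these are called block automorphisms. Let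 $D$ denote the group of block automorphisms of $L$ (in statements about $\mathrm{Aut}\,L$), and the group of block automorphisms of $K$ (in statements about $\mathrm{Aut}\,K$). Assume that: - $X$ is connected: it is nonempty, and the graph on $X/{\sim}$ in which two distinct classes are adjacent when they are comparable is connected; - Condition (II): for all $\varphi\in\mathrm{Aut}\,K$ and $x\in X$ there is $y\in X$ with $\varphi(e_x)\in e_y+M$; - Condition $(*)$: for all $\alpha\in\Omega_1$ and $x\in X$, $\alpha_x$ is the product in $\mathrm{Aut}\,R_x$ of an inner automorphism and a block automorphism. **Theorem 8.4.** 1. (a) $\Omega_1=\mathrm{In}(\mathrm{Aut}\,L)\cdot D$; (b) $\Omega_1/\mathrm{In}(\mathrm{Aut}\,L)\cong\mathrm{Out}\,P$; (c) $C=\mathrm{In}_0(\mathrm{Aut}\,K)\cdot\Psi\cdot D$. 2. $\mathrm{Out}_0K$ has a normal subgroup $H\cong\Psi/\Psi_0$ such that $\mathrm{Out}_0K/H\cong\Omega_1/\mathrm{In}(\mathrm{Aut}\,L)\cong\mathrm{Out}\,P$. -/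

import Mathlib

open scoped Pointwise

/-! ### Inner and outer automorphisms of an algebra -/

section InnerAutomorphisms

variable (T : Type*) [CommRing T] (A : Type*) [Ring A] [Algebra T A]

/-- Conjugation `a ↦ u a u⁻¹` by a unit `u`, as a homomorphism `U(A) → Aut A`. -/
def conjAut : Aˣ →* (A ≃ₐ[T] A) where
  toFun u :=
    { toFun := fun a => u * a * ↑u⁻¹
      invFun := fun a => ↑u⁻¹ * a * u
      left_inv := fun a => by simp [mul_assoc]
      right_inv := fun a => by simp [mul_assoc]
      map_mul' := fun a b => by simp [mul_assoc]
      map_add' := fun a b => by simp [mul_add, add_mul]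
      commutes' := fun t => by simp [← Algebra.commutes t (u : A), mul_assoc] }
  map_one' := by ext a; simp
  map_mul' u v := by ext a; simp [mul_assoc]

@[simp] theorem conjAut_apply (u : Aˣ) (a : A) : conjAut T A u a = u * a * ↑u⁻¹ := rfl

/-- `In(Aut A)`: the subgroup of inner automorphisms. -/
def Inn : Subgroup (A ≃ₐ[T] A) := (conjAut T A).range

theorem aut_conj_conjAut (φ : A ≃ₐ[T] A) (u : Aˣ) :
    φ * conjAut T A u * φ⁻¹ = conjAut T A (Units.map (φ : A →* A) u) := by
  ext a
  have h : (↑((Units.map (φ : A →* A) u)⁻¹) : A) = φ ↑u⁻¹ := rfl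
  simp [h]

instance Inn.normal : (Inn T A).Normal where
  conj_mem := by
    rintro _ ⟨u, rfl⟩ φ
    exact ⟨_, (aut_conj_conjAut T A φ u).symm⟩

/-- `Out A = Aut A / In(Aut A)`. -/
abbrev Out : Type _ := (A ≃ₐ[T] A) ⧸ Inn T A

end InnerAutomorphisms

namespace IncAlg

section Preorder

variable (X : Type*) [Preorder X]

/-- The partially ordered set `X̄ = X / ∼` of the classes `[x]`, where `x ∼ y` means
`x ≤ y` and `y ≤ x`. -/
abbrev Classes : Type _ := Antisymmetrization X (· ≤ ·)

/-- `X` is connected: the simple graph on `X̄` in which two different classes are adjacent when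
they are comparable is connected (so `X` is nonempty, and any two classes are
joined by a semipath). -/
def IsConnected : Prop :=
  (SimpleGraph.fromRel (fun c d : Classes X => c ≤ d)).Connected

variable {X}

/-- The class of `x`. -/
abbrev cls (x : X) : Classes X := toAntisymmetrization (· ≤ ·) x

/-- The elements of a class. -/
abbrev Fiber (c : Classes X) : Type _ := {x : X // cls x = c}

/-- The number of elements of a class. -/
noncomputable def size (c : Classes X) : ℕ := Nat.card (Fiber c)

variable (X) in
/-- A numbering of the elements of every class. -/
abbrev Numbering : Type _ := ∀ c : Classes X, Fiber c ≃ Fin (size c)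

theorem cls_eq_iff {x y : X} : cls x = cls y ↔ x ≤ y ∧ y ≤ x :=
  Quotient.eq

section Blocks

variable {k : ℕ} (hk : ∀ c : Classes X, k ∣ size c) (ν : Numbering X)

/-- The partition of the numbered elements of a class into consecutive blocks of `k` elements:
an element goes to the number of its block and its position in this block. -/
noncomputable def blockIndex (c : Classes X) : Fiber c ≃ Fin (size c / k) × Fin k :=
  (ν c).trans ((finCongr (Nat.div_mul_cancel (hk c)).symm).trans finProdFinEquiv.symm)

/-- The position of `x` in its block. -/
noncomputable def pos (x : X) : Fin k := (blockIndex hk ν (cls x) ⟨x, rfl⟩).2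

/-- The element at position `j` in the block that contains `x`. -/
noncomputable def elt (x : X) (j : Fin k) : X :=
  ((blockIndex hk ν (cls x)).symm ((blockIndex hk ν (cls x) ⟨x, rfl⟩).1, j)).1

theorem cls_elt (x : X) (j : Fin k) : cls (elt hk ν x j) = cls x :=
  ((blockIndex hk ν (cls x)).symm ((blockIndex hk ν (cls x) ⟨x, rfl⟩).1, j)).2

theorem elt_pos (x : X) : elt hk ν x (pos hk ν x) = x := by
  simp [elt, pos]

theorem pos_fiber {c : Classes X} (z : Fiber c) :
    pos hk ν z.1 = (blockIndex hk ν c z).2 := by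
  obtain ⟨z, rfl⟩ := z
  rfl

theorem elt_fiber {c : Classes X} (z : Fiber c) (j : Fin k) :
    elt hk ν z.1 j = ((blockIndex hk ν c).symm ((blockIndex hk ν c z).1, j)).1 := by
  obtain ⟨z, rfl⟩ := z
  rfl

theorem pos_elt (x : X) (j : Fin k) : pos hk ν (elt hk ν x j) = j := by
  rw [elt, pos_fiber, Equiv.apply_symm_apply]

theorem elt_elt (x : X) (i j : Fin k) : elt hk ν (elt hk ν x i) j = elt hk ν x j := by
  refine (elt_fiber hk ν ((blockIndex hk ν (cls x)).symm
    ((blockIndex hk ν (cls x) ⟨x, rfl⟩).1, i)) j).trans ?_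
  rw [Equiv.apply_symm_apply]
  rfl

theorem elt_le_elt {x y : X} {i j : Fin k} :
    elt hk ν x i ≤ elt hk ν y j ↔ x ≤ y := by
  have hx := cls_eq_iff.1 (cls_elt hk ν x i)
  have hy := cls_eq_iff.1 (cls_elt hk ν y j)
  exact ⟨fun h => hx.2.trans (h.trans hy.1), fun h => hx.1.trans (h.trans hy.2)⟩

end Blocks

end Preorder

/-! ### Blocks of a function -/

section BlocksOfFunctions

variable {R X : Type*} [Ring R] [Preorder X] {k : ℕ}
  (hk : ∀ c : Classes X, k ∣ size c) (ν : Numbering X)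

variable (R) in
/-- The matrix algebra `P = M(k, R)`. -/
abbrev P (k : ℕ) : Type _ := Matrix (Fin k) (Fin k) R

/-- The `k × k` block of `f` that contains the place `(x, y)`. -/
noncomputable def block (f : IncidenceAlgebra R X) (x y : X) : P R k :=
  Matrix.of fun i j => f (elt hk ν x i) (elt hk ν y j)

theorem block_eq_zero {f : IncidenceAlgebra R X} {x y : X} (h : ¬ x ≤ y) :
    block hk ν f x y = 0 := by
  ext i j
  exact IncidenceAlgebra.apply_eq_zero_of_not_le (fun h' => h ((elt_le_elt hk ν).1 h')) f

theorem block_elt (f : IncidenceAlgebra R X) (x y : X) (i j : Fin k) :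
    block hk ν f (elt hk ν x i) (elt hk ν y j) = block hk ν f x y := by
  ext a b
  simp [block, elt_elt]

theorem block_add (f g : IncidenceAlgebra R X) (x y : X) :
    block hk ν (f + g) x y = block hk ν f x y + block hk ν g x y := rfl

theorem block_pos (f : IncidenceAlgebra R X) (x y : X) :
    block hk ν f x y (pos hk ν x) (pos hk ν y) = f x y := by
  simp [block, elt_pos]

end BlocksOfFunctions

/-- Regrouping a sum over an interval by blocks. -/
theorem sum_Icc_blocks {A X : Type*} [AddCommMonoid A] [Preorder X] [LocallyFiniteOrder X]
    {k : ℕ} (hk : ∀ c : Classes X, k ∣ size c) (ν : Numbering X) (F : X → A) (x y : X) :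
    ∑ z ∈ Finset.Icc x y, F z =
      ∑ z ∈ (Finset.Icc x y).filter (fun z => pos hk ν z = pos hk ν x),
        ∑ i : Fin k, F (elt hk ν z i) := by
  rw [← Finset.sum_product']
  symm
  have hle : ∀ (z : X) (i : Fin k), (x ≤ elt hk ν z i ∧ elt hk ν z i ≤ y) ↔ (x ≤ z ∧ z ≤ y) := by
    intro z i
    have h := cls_eq_iff.1 (cls_elt hk ν z i)
    exact ⟨fun h' => ⟨h'.1.trans h.1, h.2.trans h'.2⟩, fun h' => ⟨h'.1.trans h.2, h.1.trans h'.2⟩⟩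
  refine Finset.sum_nbij' (fun p => elt hk ν p.1 p.2)
    (fun z => (elt hk ν z (pos hk ν x), pos hk ν z)) ?_ ?_ ?_ ?_ ?_
  · rintro ⟨z, i⟩ h
    simp only [Finset.mem_product, Finset.mem_filter, Finset.mem_Icc] at h ⊢
    exact (hle z i).2 h.1.1
  · intro z h
    simp only [Finset.mem_product, Finset.mem_filter, Finset.mem_Icc, Finset.mem_univ,
      and_true] at h ⊢
    exact ⟨(hle z _).2 h, pos_elt hk ν z _⟩
  · rintro ⟨z, i⟩ h
    simp only [Finset.mem_product, Finset.mem_filter] at h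
    simp only [pos_elt, elt_elt]
    rw [← h.1.2, elt_pos]
  · intro z _
    simp only [elt_elt, elt_pos]
  · rintro ⟨z, i⟩ _
    rfl

/-! ### The incidence algebra as an algebra over `T` -/

section Algebra

variable {T R X : Type*} [CommRing T] [Ring R] [Algebra T R]
  [Preorder X] [LocallyFiniteOrder X] [DecidableEq X]

/-- `I(X,R)` is a `T`-algebra with the pointwise action of `T`. -/
instance instAlgebra : Algebra T (IncidenceAlgebra R X) :=
  Algebra.ofModule
    (fun t f g => by
      ext a b _
      simp [IncidenceAlgebra.constSMul_apply, Finset.smul_sum])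
    (fun t f g => by
      ext a b _
      simp [IncidenceAlgebra.constSMul_apply, Finset.smul_sum])

/-- Automorphisms of the `T`-algebra `K = I(X,R)`. -/
abbrev AutK (T R X : Type*) [CommRing T] [Ring R] [Algebra T R]
    [Preorder X] [LocallyFiniteOrder X] [DecidableEq X] : Type _ :=
  IncidenceAlgebra R X ≃ₐ[T] IncidenceAlgebra R X

/-! ### The subalgebra `L`, the ideal `M`, the idempotents `e_x` and the rings `R_x` -/

variable (T R X) in
/-- `L`: the functions that vanish at `(x, y)` unless `x ∼ y`. -/
def L : Subalgebra T (IncidenceAlgebra R X) where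
  carrier := {f | ∀ x y, ¬ (x ≤ y ∧ y ≤ x) → f x y = 0}
  add_mem' := by
    intro f g hf hg x y h
    simp [hf x y h, hg x y h]
  mul_mem' := by
    intro f g hf hg x y h
    rw [IncidenceAlgebra.mul_apply]
    refine Finset.sum_eq_zero fun z hz => ?_
    rw [Finset.mem_Icc] at hz
    by_cases h1 : z ≤ x
    · by_cases h2 : y ≤ z
      · exact absurd ⟨hz.1.trans hz.2, h2.trans h1⟩ h
      · rw [hg z y (fun h3 => h2 h3.2), mul_zero]
    · rw [hf x z (fun h3 => h1 h3.2), zero_mul]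
  algebraMap_mem' := by
    intro t x y h
    rw [Algebra.algebraMap_eq_smul_one, IncidenceAlgebra.constSMul_apply,
      IncidenceAlgebra.one_apply, if_neg, smul_zero]
    rintro rfl
    exact h ⟨le_rfl, le_rfl⟩

variable (T R X) in
/-- Automorphisms of the `T`-algebra `L`. -/
abbrev AutL : Type _ := L T R X ≃ₐ[T] L T R X

variable (R X) in
/-- `M`: the functions that vanish at `(x, y)` whenever `x ∼ y`. -/
def M : TwoSidedIdeal (IncidenceAlgebra R X) :=
  TwoSidedIdeal.mk' {f | ∀ x y, x ≤ y → y ≤ x → f x y = 0}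
    (fun _ _ _ _ => rfl)
    (fun {f g} hf hg x y h h' => by simp [hf x y h h', hg x y h h'])
    (fun {f} hf x y h h' => by simp [hf x y h h'])
    (fun {f g} hg x y h h' => by
      rw [IncidenceAlgebra.mul_apply]
      refine Finset.sum_eq_zero fun z hz => ?_
      rw [Finset.mem_Icc] at hz
      rw [hg z y hz.2 (h'.trans hz.1), mul_zero])
    (fun {f g} hf x y h h' => by
      rw [IncidenceAlgebra.mul_apply]
      refine Finset.sum_eq_zero fun z hz => ?_
      rw [Finset.mem_Icc] at hz
      rw [hf x z hz.1 (hz.2.trans h'), zero_mul])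

theorem mem_M {f : IncidenceAlgebra R X} :
    f ∈ M R X ↔ ∀ x y, x ≤ y → y ≤ x → f x y = 0 := by
  simp [M, TwoSidedIdeal.mem_mk']

open Classical in
variable (R) in
/-- The idempotent `e_x = e_[x]`: it is `1` at `(t, t)` for `t ∈ [x]`, and `0` elsewhere. -/
noncomputable def e (x : X) : IncidenceAlgebra R X where
  toFun s t := if s = t ∧ cls s = cls x then 1 else 0
  eq_zero_of_not_le' s t h := if_neg fun h' => h h'.1.le

variable (T R) in
/-- `R_x = R_[x]`: the functions that vanish at `(s, t)` unless `s ∼ x` and `t ∼ x`. It is a ring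
with identity element `e_x`. -/
def Rx (x : X) : Submodule T (IncidenceAlgebra R X) where
  carrier := {f | ∀ s t, ¬ (cls s = cls x ∧ cls t = cls x) → f s t = 0}
  zero_mem' := fun _ _ _ => rfl
  add_mem' := by
    intro f g hf hg s t h
    simp [hf s t h, hg s t h]
  smul_mem' := by
    intro c f hf s t h
    simp [IncidenceAlgebra.constSMul_apply, hf s t h]

/-- Condition (II): every automorphism of `K` maps each `e_x` into some `e_y + M`. -/
def ConditionII (T R X : Type*) [CommRing T] [Ring R] [Algebra T R]
    [Preorder X] [LocallyFiniteOrder X] [DecidableEq X] : Prop :=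
  ∀ φ : AutK T R X, ∀ x : X, ∃ y : X, φ (e R x) - e R y ∈ M R X

/-! ### Subgroups of `Aut K` and `Aut L` -/

/-- `φ` is triangular: `φ M = M`. -/
def IsTriangular (φ : AutK T R X) : Prop :=
  ∀ f : IncidenceAlgebra R X, φ f ∈ M R X ↔ f ∈ M R X

/-- `α` is the upper left entry of the matrix of `φ` with respect to `K = L ⊕ M`, that is,
`α a` is the component in `L` of `φ a` for `a ∈ L`. -/
def IsEntryL (φ : AutK T R X) (α : AutL T R X) : Prop :=
  ∀ a : L T R X, φ (a : IncidenceAlgebra R X) - (α a : IncidenceAlgebra R X) ∈ M R X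

variable (T R X) in
/-- `Ω`: the automorphisms of `L` that are the upper left entry `α` of the matrix of a
triangular automorphism of `K`. -/
def Omega : Subgroup (AutL T R X) where
  carrier := {α | ∃ φ : AutK T R X, IsTriangular φ ∧ IsEntryL φ α}
  one_mem' := ⟨1, fun _ => Iff.rfl, fun a => by
    simp [(M R X).zero_mem]⟩
  mul_mem' := by
    rintro α β ⟨φ, hφ, hα⟩ ⟨ψ, hψ, hβ⟩
    refine ⟨φ * ψ, fun f => (hφ _).trans (hψ f), fun a => ?_⟩
    have h := (M R X).add_mem ((hφ _).2 (hβ a)) (hα (β a))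
    rwa [map_sub, sub_add_sub_cancel] at h
  inv_mem' := by
    rintro α ⟨φ, hφ, hα⟩
    have h1 : ∀ f, φ (φ⁻¹ f) = f := φ.apply_symm_apply
    have h2 : ∀ a, α (α⁻¹ a) = a := α.apply_symm_apply
    refine ⟨φ⁻¹, fun f => ?_, fun a => ?_⟩
    · rw [← hφ, h1]
    · have h := hα (α⁻¹ a)
      rw [h2] at h
      rw [← hφ, map_sub, h1, ← neg_sub]
      exact (M R X).neg_mem h

variable (T R X) in
/-- `Ω₁ = {α ∈ Ω ∣ α R_x = R_x for all x}`. -/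
def Omega1 : Subgroup (AutL T R X) where
  carrier := {α | α ∈ Omega T R X ∧ ∀ (x : X) (a : L T R X),
    (α a : IncidenceAlgebra R X) ∈ Rx T R x ↔ (a : IncidenceAlgebra R X) ∈ Rx T R x}
  one_mem' := ⟨one_mem _, fun _ _ => Iff.rfl⟩
  mul_mem' := fun ha hb => ⟨mul_mem ha.1 hb.1, fun x a => (ha.2 x _).trans (hb.2 x a)⟩
  inv_mem' := by
    rintro α ⟨h, hα⟩
    refine ⟨inv_mem h, fun x a => ?_⟩
    have h2 : α (α⁻¹ a) = a := α.apply_symm_apply a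
    rw [← hα, h2]

variable (T R X) in
/-- `Λ`: the diagonal automorphisms of `K`, that is, `φ L = L` and `φ M = M`. -/
def Lambda : Subgroup (AutK T R X) where
  carrier := {φ | (∀ f, φ f ∈ L T R X ↔ f ∈ L T R X) ∧ ∀ f, φ f ∈ M R X ↔ f ∈ M R X}
  one_mem' := ⟨fun _ => Iff.rfl, fun _ => Iff.rfl⟩
  mul_mem' := fun ha hb =>
    ⟨fun f => (ha.1 _).trans (hb.1 f), fun f => (ha.2 _).trans (hb.2 f)⟩
  inv_mem' := by
    rintro φ ⟨h, h'⟩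
    have h2 : ∀ f, φ (φ⁻¹ f) = f := φ.apply_symm_apply
    exact ⟨fun f => by rw [← h, h2], fun f => by rw [← h', h2]⟩

variable (T R X) in
/-- `C`: the diagonal automorphisms `φ` of `K` with `φ R_x = R_x` for all `x`. -/
def C : Subgroup (AutK T R X) where
  carrier := {φ | φ ∈ Lambda T R X ∧ ∀ (x : X) (f : IncidenceAlgebra R X),
    φ f ∈ Rx T R x ↔ f ∈ Rx T R x}
  one_mem' := ⟨one_mem _, fun _ _ => Iff.rfl⟩
  mul_mem' := fun ha hb => ⟨mul_mem ha.1 hb.1, fun x f => (ha.2 x _).trans (hb.2 x f)⟩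
  inv_mem' := by
    rintro φ ⟨h, hφ⟩
    have h2 : ∀ f, φ (φ⁻¹ f) = f := φ.apply_symm_apply
    exact ⟨inv_mem h, fun x f => by rw [← hφ, h2]⟩

variable (T R X) in
/-- `Ψ`: the diagonal automorphisms of `K` that are the identity on `L`. -/
def Psi : Subgroup (AutK T R X) where
  carrier := {φ | φ ∈ Lambda T R X ∧ ∀ f ∈ L T R X, φ f = f}
  one_mem' := ⟨one_mem _, fun _ _ => rfl⟩
  mul_mem' := by
    rintro φ ψ ⟨h, hφ⟩ ⟨h', hψ⟩
    refine ⟨mul_mem h h', fun f hf => ?_⟩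
    rw [AlgEquiv.mul_apply, hψ f hf, hφ f hf]
  inv_mem' := by
    rintro φ ⟨h, hφ⟩
    refine ⟨inv_mem h, fun f hf => ?_⟩
    have h1 : φ⁻¹ (φ f) = f := φ.symm_apply_apply f
    rwa [hφ f hf] at h1

variable (T R X) in
/-- `In₀(Aut K)`: the inner automorphisms of `K` defined by the invertible elements of `L`. -/
def Inn0 : Subgroup (AutK T R X) :=
  ((conjAut T (IncidenceAlgebra R X)).comp (Units.map (L T R X).val.toMonoidHom)).range

variable (T R X) in
/-- `Ψ₀`: the inner automorphisms of `K` defined by the invertible central elements of `L`. -/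
def Psi0 : Subgroup (AutK T R X) :=
  (Submonoid.center (L T R X)).units.map
    ((conjAut T (IncidenceAlgebra R X)).comp (Units.map (L T R X).val.toMonoidHom))

instance inn0_normal : ((Inn0 T R X).subgroupOf (C T R X)).Normal where
  conj_mem := by
    rintro ⟨_, _⟩ ⟨u, rfl⟩ ⟨φ, hφ⟩
    have hL : ∀ f, φ f ∈ L T R X ↔ f ∈ L T R X := hφ.1.1
    refine ⟨⟨⟨φ (u : L T R X), (hL _).2 (u : L T R X).2⟩,
      ⟨φ (↑u⁻¹ : L T R X), (hL _).2 (↑u⁻¹ : L T R X).2⟩, ?_, ?_⟩, ?_⟩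
    · apply Subtype.ext
      change φ _ * φ _ = 1
      rw [← map_mul, ← (L T R X).coe_mul, Units.mul_inv]
      exact map_one φ
    · apply Subtype.ext
      change φ _ * φ _ = 1
      rw [← map_mul, ← (L T R X).coe_mul, Units.inv_mul]
      exact map_one φ
    · refine Eq.trans ?_ (aut_conj_conjAut T (IncidenceAlgebra R X) φ _).symm
      change conjAut _ _ _ = conjAut _ _ _
      rfl

instance psi0_normal : ((Psi0 T R X).subgroupOf (Psi T R X)).Normal where
  conj_mem := by
    rintro ⟨_, _⟩ ⟨u, hu, rfl⟩ ⟨φ, hφ⟩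
    refine ⟨u, hu, ?_⟩
    refine Eq.trans ?_ (aut_conj_conjAut T (IncidenceAlgebra R X) φ _).symm
    change conjAut _ _ _ = conjAut _ _ _
    congr 1
    exact Units.ext (hφ.2 _ (u : L T R X).2).symm

variable (T R X) in
/-- `Out₀ K = C / In₀(Aut K)`. -/
abbrev Out0 : Type _ := C T R X ⧸ (Inn0 T R X).subgroupOf (C T R X)

/-! ### Block automorphisms -/

/-! ### Ring (block) automorphisms -/

section Block

variable {k : ℕ} (hk : ∀ c : Classes X, k ∣ size c) (ν : Numbering X)

theorem block_smul (t : T) (f : IncidenceAlgebra R X) (x y : X) :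
    block hk ν (t • f) x y = t • block hk ν f x y := rfl

theorem block_mul (f g : IncidenceAlgebra R X) (x y : X) :
    block hk ν (f * g) x y =
      ∑ z ∈ (Finset.Icc x y).filter (fun z => pos hk ν z = pos hk ν x),
        block hk ν f x z * block hk ν g z y := by
  ext i j
  rw [Matrix.sum_apply]
  change (f * g) (elt hk ν x i) (elt hk ν y j) = _
  rw [IncidenceAlgebra.mul_apply]
  have hI : Finset.Icc (elt hk ν x i) (elt hk ν y j) = Finset.Icc x y := by
    ext z
    have hx := cls_eq_iff.1 (cls_elt hk ν x i)
    have hy := cls_eq_iff.1 (cls_elt hk ν y j)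
    simp only [Finset.mem_Icc]
    exact ⟨fun h => ⟨hx.2.trans h.1, h.2.trans hy.1⟩, fun h => ⟨hx.1.trans h.1, h.2.trans hy.2⟩⟩
  rw [hI, sum_Icc_blocks hk ν]
  rfl

/-- The result of applying `ε ∈ Aut P` to every `k × k` block of `f`. -/
noncomputable def blockMap (ε : P R k ≃ₐ[T] P R k) (f : IncidenceAlgebra R X) :
    IncidenceAlgebra R X where
  toFun x y := ε (block hk ν f x y) (pos hk ν x) (pos hk ν y)
  eq_zero_of_not_le' x y h := by rw [block_eq_zero hk ν h, map_zero]; rfl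

theorem blockMap_apply (ε : P R k ≃ₐ[T] P R k) (f : IncidenceAlgebra R X) (x y : X) :
    blockMap hk ν ε f x y = ε (block hk ν f x y) (pos hk ν x) (pos hk ν y) := rfl

theorem block_blockMap (ε : P R k ≃ₐ[T] P R k) (f : IncidenceAlgebra R X) (x y : X) :
    block hk ν (blockMap hk ν ε f) x y = ε (block hk ν f x y) := by
  ext i j
  change blockMap hk ν ε f (elt hk ν x i) (elt hk ν y j) = _
  rw [blockMap_apply, block_elt, pos_elt, pos_elt]

theorem ext_block {f g : IncidenceAlgebra R X}
    (h : ∀ x y, block hk ν f x y = block hk ν g x y) : f = g := by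
  ext x y _
  rw [← block_pos hk ν f, h, block_pos]

/-- Applying `ε ∈ Aut P` to every `k × k` block is a ring automorphism of `K`. -/
noncomputable def blockRingEquiv (ε : P R k ≃ₐ[T] P R k) :
    IncidenceAlgebra R X ≃+* IncidenceAlgebra R X where
  toFun := blockMap hk ν ε
  invFun := blockMap hk ν ε.symm
  left_inv := fun f => ext_block hk ν fun x y => by simp [block_blockMap]
  right_inv := fun f => ext_block hk ν fun x y => by simp [block_blockMap]
  map_mul' := fun f g => ext_block hk ν fun x y => by
    rw [block_blockMap, block_mul, block_mul, map_sum]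
    simp only [map_mul, block_blockMap]
  map_add' := fun f g => ext_block hk ν fun x y => by
    simp only [block_blockMap, block_add, map_add]

theorem blockRingEquiv_algebraMap (ε : P R k ≃ₐ[T] P R k) (t : T) :
    blockRingEquiv hk ν ε (algebraMap T (IncidenceAlgebra R X) t) =
      algebraMap T (IncidenceAlgebra R X) t := by
  rw [Algebra.algebraMap_eq_smul_one]
  conv_rhs => rw [← map_one (blockRingEquiv hk ν ε)]
  refine ext_block hk ν fun x y => ?_
  change block hk ν (blockMap hk ν ε (t • 1)) x y = block hk ν (t • blockMap hk ν ε 1) x y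
  rw [block_blockMap, block_smul, block_smul, block_blockMap, map_smul]

/-- The ring (block) automorphism of `K` induced by `ε ∈ Aut P`. -/
noncomputable def blockAut : (P R k ≃ₐ[T] P R k) →* AutK T R X where
  toFun ε := AlgEquiv.ofRingEquiv (f := blockRingEquiv hk ν ε) (blockRingEquiv_algebraMap hk ν ε)
  map_one' := AlgEquiv.ext fun f => ext_block hk ν fun x y => block_blockMap hk ν 1 f x y
  map_mul' ε δ := AlgEquiv.ext fun f => ext_block hk ν fun x y => by
    change block hk ν (blockMap hk ν (ε * δ) f) x y =
      block hk ν (blockMap hk ν ε (blockMap hk ν δ f)) x y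
    simp only [block_blockMap]
    rfl

theorem block_blockAut (ε : P R k ≃ₐ[T] P R k) (f : IncidenceAlgebra R X) (x y : X) :
    block hk ν (blockAut hk ν ε f) x y = ε (block hk ν f x y) :=
  block_blockMap hk ν ε f x y

variable (T R) in
/-- `D` in `Aut K`: the ring (block) automorphisms of `K` induced by the automorphisms of `P`. -/
noncomputable def DK : Subgroup (AutK T R X) := (blockAut (T := T) (R := R) hk ν).range

variable (T R) in
/-- `D` in `Aut L`: the ring (block) automorphisms of `L`, that is, the restrictions to `L` of the
ring automorphisms of `K`. -/
noncomputable def DL : Subgroup (AutL T R X) where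
  carrier := {α | ∃ ε : P R k ≃ₐ[T] P R k, ∀ a : L T R X,
    (α a : IncidenceAlgebra R X) = blockAut hk ν ε (a : IncidenceAlgebra R X)}
  one_mem' := ⟨1, fun a => by rw [map_one]; rfl⟩
  mul_mem' := by
    rintro α β ⟨ε, hε⟩ ⟨δ, hδ⟩
    refine ⟨ε * δ, fun a => ?_⟩
    rw [AlgEquiv.mul_apply, hε, hδ, map_mul, AlgEquiv.mul_apply]
  inv_mem' := by
    rintro α ⟨ε, hε⟩
    refine ⟨ε⁻¹, fun a => ?_⟩
    have h := hε (α⁻¹ a)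
    have h2 : α (α⁻¹ a) = a := α.apply_symm_apply a
    rw [h2] at h
    rw [h, ← AlgEquiv.mul_apply, ← map_mul, inv_mul_cancel, map_one]
    rfl

variable (T R) in
/-- Condition (∗): for every `α ∈ Ω₁` and every `x`, the restriction `α_x : R_x → R_x` of `α` is
the product in `Aut R_x` of an inner automorphism `b ↦ u b v`, where `u` and `v` are inverse to
each other in the ring `R_x` with identity element `e_x`, and a ring (block) automorphism. -/
def ConditionStar : Prop :=
  ∀ α ∈ Omega1 T R X, ∀ x : X,
    ∃ u ∈ Rx T R x, ∃ v ∈ Rx T R x, u * v = e R x ∧ v * u = e R x ∧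
      ∃ ε : P R k ≃ₐ[T] P R k, ∀ a : L T R X, (a : IncidenceAlgebra R X) ∈ Rx T R x →
        (α a : IncidenceAlgebra R X) = u * blockAut hk ν ε (a : IncidenceAlgebra R X) * v

end Block

end Algebra

end IncAlg

/-! Everything rests on restriction to `L`, the homomorphism `restrictHom : C → Ω₁`, whose kernel is
`Ψ`. The main point is that it is onto, and more precisely that every `α ∈ Ω₁` is conjugation by a
unit of `L` composed with one block automorphism.

By condition (∗), `α` acts on each `R_x` as a block automorphism `ε_x` followed by conjugation by a
unit `u_x` of `R_x`; a priori `ε_x` depends on `x`. Let `φ` be a triangular automorphism with upper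
left entry `α`, and let `[y]` cover `[x]`. Then `e_x M M e_y = 0`, so the components of `φ` from `L`
to `M` do not contribute on the block at `(x, y)`. After removal of `u_x` and `u_y`, `φ` induces
there a surjective `τ : P → P` with `τ (a p b) = ε_x a · τ p · ε_y b` (`block_semilinear`). Hence `τ
1` is a unit that conjugates `ε_y` into `ε_x`, and the two agree in `Out P` (`mk_eq_mk_of_covers`).
Finiteness of intervals extends this to comparable classes, connectedness to all classes. The
remaining inner differences are absorbed into the `u_x`, and the corrected units are glued to a unit
of `L` (`exists_blockAut_conj`).

Conjugations by units of `L` and block automorphisms extend to `K`, which gives both product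
decompositions. A block automorphism of `L` is inner exactly when `ε` is
(`restrictHom_blockC_mem_Inn_iff`), whence `Out P`. Finally `H` is the kernel of the induced map
`Out₀ K → Ω₁ / In(Aut L)`. It is the image of `Ψ`, and `Ψ ∩ In₀ = Ψ₀`. -/

namespace IncAlg

/-! ### Multiplication by the idempotents `e_x`, and gluing elements of the rings `R_x` -/

section Elements

variable {T R X : Type*} [CommRing T] [Ring R] [Algebra T R]
  [Preorder X] [LocallyFiniteOrder X] [DecidableEq X]

theorem mem_L {f : IncidenceAlgebra R X} :
    f ∈ L T R X ↔ ∀ x y, cls x ≠ cls y → f x y = 0 := by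
  simp only [ne_eq, cls_eq_iff]
  exact Iff.rfl

theorem mem_M_iff_cls {f : IncidenceAlgebra R X} :
    f ∈ M R X ↔ ∀ x y, cls x = cls y → f x y = 0 := by
  simp only [mem_M, cls_eq_iff, and_imp]

theorem mem_Rx {x : X} {f : IncidenceAlgebra R X} :
    f ∈ Rx T R x ↔ ∀ s t, ¬ (cls s = cls x ∧ cls t = cls x) → f s t = 0 := Iff.rfl

theorem Rx_le_L {x : X} {f : IncidenceAlgebra R X} (hf : f ∈ Rx T R x) : f ∈ L T R X :=
  mem_L.2 fun s t h => hf s t fun h' => h (h'.1.trans h'.2.symm)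

open Classical in
theorem e_apply (x s t : X) : e R x s t = if s = t ∧ cls s = cls x then 1 else 0 := by
  rw [e, IncidenceAlgebra.coe_mk]

open Classical in
theorem e_mul_apply (x : X) (f : IncidenceAlgebra R X) (s t : X) :
    (e R x * f) s t = if cls s = cls x then f s t else 0 := by
  rw [IncidenceAlgebra.mul_apply]
  by_cases hst : s ≤ t
  · rw [Finset.sum_eq_single s]
    · by_cases h : cls s = cls x <;> simp [e_apply, h]
    · intro z _ hz
      simp [e_apply, hz.symm]
    · simp [hst]
  · rw [Finset.Icc_eq_empty hst, IncidenceAlgebra.apply_eq_zero_of_not_le hst]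
    simp

open Classical in
theorem mul_e_apply (x : X) (f : IncidenceAlgebra R X) (s t : X) :
    (f * e R x) s t = if cls t = cls x then f s t else 0 := by
  rw [IncidenceAlgebra.mul_apply]
  by_cases hst : s ≤ t
  · rw [Finset.sum_eq_single t]
    · by_cases h : cls t = cls x <;> simp [e_apply, h]
    · intro z _ hz
      simp [e_apply, hz]
    · simp [hst]
  · rw [Finset.Icc_eq_empty hst, IncidenceAlgebra.apply_eq_zero_of_not_le hst]
    simp

theorem e_mem_Rx (x : X) : e R x ∈ Rx T R x := by
  intro s t h
  rw [e_apply, if_neg]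
  rintro ⟨rfl, h'⟩
  exact h ⟨h', h'⟩

theorem e_mul_of_mem {x : X} {f : IncidenceAlgebra R X} (hf : f ∈ Rx T R x) :
    e R x * f = f := by
  ext s t _
  rw [e_mul_apply]
  split_ifs with h
  · rfl
  · exact (hf s t fun h' => h h'.1).symm

theorem mul_e_of_mem {x : X} {f : IncidenceAlgebra R X} (hf : f ∈ Rx T R x) :
    f * e R x = f := by
  ext s t _
  rw [mul_e_apply]
  split_ifs with h
  · rfl
  · exact (hf s t fun h' => h h'.2).symm

theorem e_mul_mul_e_mem (x : X) (f : IncidenceAlgebra R X) : e R x * f * e R x ∈ Rx T R x := by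
  intro s t h
  rw [mul_e_apply, e_mul_apply]
  split_ifs with h1 h2
  · exact absurd ⟨h2, h1⟩ h
  all_goals rfl

theorem e_mul_comm_of_mem_L {f : IncidenceAlgebra R X} (hf : f ∈ L T R X) (x : X) :
    e R x * f = f * e R x := by
  ext s t _
  rw [e_mul_apply, mul_e_apply]
  by_cases h : cls s = cls t
  · rw [h]
  · simp [mem_L.1 hf s t h]

theorem e_mul_e_of_ne {x y : X} (h : cls x ≠ cls y) : e R x * e R y = 0 := by
  ext s t _
  rw [e_mul_apply, e_apply]
  split_ifs with h1 h2
  · exact absurd (h1.symm.trans h2.2) h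
  all_goals rfl

theorem e_congr {x y : X} (h : cls x = cls y) : e R x = e R y := by
  ext s t _
  rw [e_apply, e_apply, h]

theorem Rx_congr {x y : X} (h : cls x = cls y) : Rx T R x = Rx T R y := by
  ext f
  rw [mem_Rx, mem_Rx, h]

/-- If no class lies strictly between `[x]` and `[y]`, then `e_x M M e_y = 0`. -/
theorem e_mul_mul_mul_e_eq_zero {x y : X} (hxy : ∀ z, x ≤ z → z ≤ y → z ≤ x ∨ y ≤ z)
    {f g : IncidenceAlgebra R X} (hf : f ∈ M R X) (hg : g ∈ M R X) :
    e R x * (f * g) * e R y = 0 := by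
  ext s t _
  rw [mul_e_apply, e_mul_apply]
  split_ifs with h1 h2
  · rw [IncidenceAlgebra.mul_apply]
    refine Finset.sum_eq_zero fun z hz => ?_
    rw [Finset.mem_Icc] at hz
    -- The middle index `z` lies in `[x]` or in `[y]`, so one of the two factors is an entry of an
    -- element of `M` inside a single class.
    rw [cls_eq_iff] at h1 h2
    rcases hxy z (h2.2.trans hz.1) (hz.2.trans h1.1) with h | h
    · rw [mem_M.1 hf s z hz.1 (h.trans h2.2), zero_mul]
    · rw [mem_M.1 hg z t hz.2 (h1.1.trans h), mul_zero]
  all_goals rfl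

/-- The element of `K` whose rows indexed by the class `c` are those of `F c`. -/
def glue (F : Classes X → IncidenceAlgebra R X) : IncidenceAlgebra R X where
  toFun s t := F (cls s) s t
  eq_zero_of_not_le' _ _ h := IncidenceAlgebra.apply_eq_zero_of_not_le h _

theorem glue_apply (F : Classes X → IncidenceAlgebra R X) (s t : X) :
    glue F s t = F (cls s) s t := by
  rw [glue, IncidenceAlgebra.coe_mk]

theorem glue_mem_L {F : Classes X → IncidenceAlgebra R X}
    (hF : ∀ x : X, F (cls x) ∈ Rx T R x) : glue F ∈ L T R X :=
  mem_L.2 fun s t h => by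
    rw [glue_apply]
    exact hF s s t fun h' => h h'.2.symm

theorem glue_mul_apply (F : Classes X → IncidenceAlgebra R X) (f : IncidenceAlgebra R X)
    (s t : X) : (glue F * f) s t = (F (cls s) * f) s t := by
  simp only [IncidenceAlgebra.mul_apply, glue_apply]

theorem mul_glue_apply {F : Classes X → IncidenceAlgebra R X}
    (hF : ∀ x : X, F (cls x) ∈ Rx T R x) (f : IncidenceAlgebra R X)
    (s t : X) : (f * glue F) s t = (f * F (cls t)) s t := by
  simp only [IncidenceAlgebra.mul_apply, glue_apply]
  -- Column `t` of `glue F` involves other rows `z` through `F (cls z)`, but these entries vanish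
  -- unless `z ∼ t`.
  refine Finset.sum_congr rfl fun z _ => ?_
  by_cases h : cls z = cls t
  · rw [h]
  · rw [hF z z t fun h' => h h'.2.symm, hF t z t fun h' => h h'.1]

theorem glue_mul_glue {F G : Classes X → IncidenceAlgebra R X}
    (hF : ∀ x : X, F (cls x) ∈ Rx T R x) (hG : ∀ x : X, G (cls x) ∈ Rx T R x)
    (h : ∀ x : X, F (cls x) * G (cls x) = e R x) : glue F * glue G = 1 := by
  ext s t _
  rw [glue_mul_apply, mul_glue_apply hG]
  by_cases hst : cls s = cls t
  · rw [← hst, h, e_apply, IncidenceAlgebra.one_apply]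
    simp
  · rw [← mul_e_of_mem (hF s), ← e_mul_of_mem (hG t), mul_assoc, ← mul_assoc (e R s),
      e_mul_e_of_ne hst, IncidenceAlgebra.one_apply, if_neg (fun h' => hst (by rw [h']))]
    simp

end Elements

/-! ### Functions supported on one block or constant along the block diagonal -/

section BlockElements

variable {T R X : Type*} [CommRing T] [Ring R] [Algebra T R]
  [Preorder X] [LocallyFiniteOrder X] [DecidableEq X]
  {k : ℕ} (hk : ∀ c : Classes X, k ∣ size c) (ν : Numbering X)

theorem cls_eq_of_elt_eq {x y : X} (h : elt hk ν x = elt hk ν y) : cls x = cls y := by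
  rw [← cls_elt hk ν x (pos hk ν x), h, cls_elt]

theorem elt_elt_fun (x : X) (i : Fin k) : elt hk ν (elt hk ν x i) = elt hk ν x :=
  funext fun j => elt_elt hk ν x i j

open Classical in
/-- The function with the matrix `p` in the block of `(x, y)` and `0` elsewhere
(and `0` if `x ≰ y`). -/
noncomputable def singleBlock (x y : X) (p : P R k) : IncidenceAlgebra R X where
  toFun s t := if elt hk ν s = elt hk ν x ∧ elt hk ν t = elt hk ν y ∧ s ≤ t then
    p (pos hk ν s) (pos hk ν t) else 0
  eq_zero_of_not_le' _ _ h := if_neg fun h' => h h'.2.2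

open Classical in
/-- The block diagonal function with the matrix `p` in every diagonal block. -/
noncomputable def scalarBlock (p : P R k) : IncidenceAlgebra R X where
  toFun s t := if elt hk ν s = elt hk ν t then p (pos hk ν s) (pos hk ν t) else 0
  eq_zero_of_not_le' _ _ h := if_neg fun h' => h (cls_eq_iff.1 (cls_eq_of_elt_eq hk ν h')).1

open Classical in
theorem block_singleBlock {x y : X} (hxy : x ≤ y) (p : P R k) (s t : X) :
    block hk ν (singleBlock hk ν x y p) s t =
      if elt hk ν s = elt hk ν x ∧ elt hk ν t = elt hk ν y then p else 0 := by
  ext i j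
  change singleBlock hk ν x y p (elt hk ν s i) (elt hk ν t j) = _
  rw [singleBlock, IncidenceAlgebra.coe_mk]
  simp only [elt_elt_fun, pos_elt, elt_le_elt]
  by_cases h : elt hk ν s = elt hk ν x ∧ elt hk ν t = elt hk ν y
  · have h1 := cls_eq_iff.1 (cls_eq_of_elt_eq hk ν h.1)
    have h2 := cls_eq_iff.1 (cls_eq_of_elt_eq hk ν h.2)
    rw [if_pos h, if_pos ⟨h.1, h.2, h1.1.trans (hxy.trans h2.2)⟩]
  · rw [if_neg h, if_neg fun h' => h ⟨h'.1, h'.2.1⟩]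
    rfl

open Classical in
theorem block_scalarBlock (p : P R k) (s t : X) :
    block hk ν (scalarBlock hk ν p) s t = if elt hk ν s = elt hk ν t then p else 0 := by
  ext i j
  change scalarBlock hk ν p (elt hk ν s i) (elt hk ν t j) = _
  rw [scalarBlock, IncidenceAlgebra.coe_mk]
  simp only [elt_elt_fun, pos_elt]
  split_ifs <;> rfl

/-- A block of a product in which only one term of the sum is nonzero. -/
theorem block_mul_eq_single {f g : IncidenceAlgebra R X} {x y z : X}
    (hz : cls z = cls x ∨ cls z = cls y)
    (h : ∀ w, elt hk ν w ≠ elt hk ν z → block hk ν f x w = 0 ∨ block hk ν g w y = 0) :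
    block hk ν (f * g) x y = block hk ν f x z * block hk ν g z y := by
  rw [block_mul]
  -- The sum in `block_mul` takes from each block the element in the position of `x`, so `z` is
  -- replaced by that element of its own block.
  rw [← block_elt hk ν f x z (pos hk ν x) (pos hk ν x),
    ← block_elt hk ν g z y (pos hk ν x) (pos hk ν y), elt_pos, elt_pos]
  have hz' : cls (elt hk ν z (pos hk ν x)) = cls x ∨ cls (elt hk ν z (pos hk ν x)) = cls y := by
    rwa [cls_elt]
  rw [cls_eq_iff, cls_eq_iff] at hz'
  refine Finset.sum_eq_single _ (fun w hw hne => ?_) fun hn => ?_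
  · have : elt hk ν w ≠ elt hk ν z := fun h' => hne (by
      rw [← h', ← (Finset.mem_filter.1 hw).2, elt_pos])
    rcases h w this with h | h <;> simp [h]
  -- If `x ≤ y`, the index is in the interval because it is equivalent to an endpoint; otherwise a
  -- factor of the remaining term vanishes.
  · by_cases hxy : x ≤ y
    · refine absurd ?_ hn
      simp only [Finset.mem_filter, Finset.mem_Icc, pos_elt, and_true]
      rcases hz' with h | h
      · exact ⟨h.2, h.1.trans hxy⟩
      · exact ⟨hxy.trans h.2, h.1⟩
    · rcases hz' with h | h
      · rw [block_eq_zero hk ν (f := g) fun h' => hxy (h.2.trans h'), mul_zero]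
      · rw [block_eq_zero hk ν (f := f) fun h' => hxy (h'.trans h.1), zero_mul]

theorem block_singleBlock_mul (x : X) (p : P R k) (f : IncidenceAlgebra R X) (t : X) :
    block hk ν (singleBlock hk ν x x p * f) x t = p * block hk ν f x t := by
  rw [block_mul_eq_single hk ν (z := x) (Or.inl rfl), block_singleBlock hk ν le_rfl]
  · simp
  · intro w hw
    left
    rw [block_singleBlock hk ν le_rfl, if_neg (by simp [hw])]

theorem block_mul_singleBlock (x : X) (p : P R k) (f : IncidenceAlgebra R X) (s : X) :
    block hk ν (f * singleBlock hk ν x x p) s x = block hk ν f s x * p := by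
  rw [block_mul_eq_single hk ν (z := x) (Or.inr rfl), block_singleBlock hk ν le_rfl]
  · simp
  · intro w hw
    right
    rw [block_singleBlock hk ν le_rfl, if_neg (by simp [hw])]

theorem block_mul_singleBlock_of_ne {x t : X} (h : elt hk ν t ≠ elt hk ν x) (p : P R k)
    (f : IncidenceAlgebra R X) (s : X) :
    block hk ν (f * singleBlock hk ν x x p) s t = 0 := by
  rw [block_mul]
  refine Finset.sum_eq_zero fun z _ => ?_
  rw [block_singleBlock hk ν le_rfl, if_neg (by simp [h]), mul_zero]

theorem block_singleBlock_mul_of_ne {x s : X} (h : elt hk ν s ≠ elt hk ν x) (p : P R k)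
    (f : IncidenceAlgebra R X) (t : X) :
    block hk ν (singleBlock hk ν x x p * f) s t = 0 := by
  rw [block_mul]
  refine Finset.sum_eq_zero fun z _ => ?_
  rw [block_singleBlock hk ν le_rfl, if_neg (by simp [h]), zero_mul]

theorem block_congr (f : IncidenceAlgebra R X) {s s' t t' : X} (hs : elt hk ν s = elt hk ν s')
    (ht : elt hk ν t = elt hk ν t') : block hk ν f s t = block hk ν f s' t' := by
  simp only [block, hs, ht]

theorem singleBlock_mul_mul_singleBlock {x y : X} (hxy : x ≤ y) (p q : P R k)
    (f : IncidenceAlgebra R X) :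
    singleBlock hk ν x x p * f * singleBlock hk ν y y q =
      singleBlock hk ν x y (p * block hk ν f x y * q) := by
  refine ext_block hk ν fun s t => ?_
  rw [block_singleBlock hk ν hxy]
  by_cases ht : elt hk ν t = elt hk ν y
  · by_cases hs : elt hk ν s = elt hk ν x
    · rw [if_pos ⟨hs, ht⟩, block_congr hk ν _ hs ht, block_mul_singleBlock, block_singleBlock_mul]
    · rw [if_neg (by simp [hs]), mul_assoc, block_singleBlock_mul_of_ne hk ν hs]
  · rw [if_neg (by simp [ht]), block_mul_singleBlock_of_ne hk ν ht]

theorem block_scalarBlock_mul (p : P R k) (f : IncidenceAlgebra R X) (s t : X) :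
    block hk ν (scalarBlock hk ν p * f) s t = p * block hk ν f s t := by
  rw [block_mul_eq_single hk ν (z := s) (Or.inl rfl), block_scalarBlock, if_pos rfl]
  intro w hw
  left
  rw [block_scalarBlock, if_neg hw.symm]

theorem block_mul_scalarBlock (p : P R k) (f : IncidenceAlgebra R X) (s t : X) :
    block hk ν (f * scalarBlock hk ν p) s t = block hk ν f s t * p := by
  rw [block_mul_eq_single hk ν (z := t) (Or.inr rfl), block_scalarBlock, if_pos rfl]
  intro w hw
  right
  rw [block_scalarBlock, if_neg hw]

theorem scalarBlock_mul (p q : P R k) :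
    scalarBlock hk ν (p * q) = scalarBlock hk ν p * scalarBlock (R := R) hk ν q := by
  refine ext_block hk ν fun s t => ?_
  rw [block_scalarBlock_mul, block_scalarBlock, block_scalarBlock]
  split_ifs <;> simp

theorem scalarBlock_one : scalarBlock (R := R) hk ν 1 = 1 := by
  refine ext_block hk ν fun s t => ?_
  rw [← mul_one (scalarBlock hk ν 1), block_scalarBlock_mul, one_mul]

theorem scalarBlock_mem_L (p : P R k) : scalarBlock hk ν p ∈ L T R X :=
  mem_L.2 fun s t h => by
    rw [← block_pos hk ν, block_scalarBlock, if_neg fun h' => h (cls_eq_of_elt_eq hk ν h')]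
    rfl

theorem singleBlock_mem_Rx (x : X) (p : P R k) : singleBlock hk ν x x p ∈ Rx T R x := by
  intro s t h
  rw [← block_pos hk ν, block_singleBlock hk ν le_rfl, if_neg]
  · rfl
  · exact fun h' => h ⟨cls_eq_of_elt_eq hk ν h'.1, cls_eq_of_elt_eq hk ν h'.2⟩

theorem singleBlock_mem_M {x y : X} (hxy : x ≤ y) (hyx : ¬ y ≤ x) (p : P R k) :
    singleBlock hk ν x y p ∈ M R X :=
  mem_M_iff_cls.2 fun s t h => by
    rw [← block_pos hk ν, block_singleBlock hk ν hxy, if_neg]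
    · rfl
    · intro h'
      have h1 := cls_eq_of_elt_eq hk ν h'.1
      have h2 := cls_eq_of_elt_eq hk ν h'.2
      exact hyx (cls_eq_iff.1 (h2.symm.trans (h.symm.trans h1))).1

theorem blockAut_singleBlock (ε : P R k ≃ₐ[T] P R k) {x y : X} (hxy : x ≤ y) (p : P R k) :
    blockAut hk ν ε (singleBlock hk ν x y p) = singleBlock hk ν x y (ε p) := by
  refine ext_block hk ν fun s t => ?_
  rw [block_blockAut, block_singleBlock hk ν hxy, block_singleBlock hk ν hxy]
  split_ifs <;> simp

/-- Multiplication by a scalar block matrix multiplies every block separately. Thus an inner change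
of `ε` can be moved into conjugation by a unit of `L`. -/
theorem blockAut_conjAut (w : (P R k)ˣ) (f : IncidenceAlgebra R X) :
    blockAut hk ν (conjAut T (P R k) w) f =
      scalarBlock hk ν w * f * scalarBlock hk ν (↑w⁻¹ : P R k) := by
  refine ext_block hk ν fun s t => ?_
  rw [block_blockAut, block_mul_scalarBlock, block_scalarBlock_mul, conjAut_apply]

/-- A block lies over a single pair of classes, so a vanishing condition in terms of classes kills
whole blocks. The cases `L`, `M` and `R_x` differ only in the choice of `Q`. -/
theorem blockAut_apply_eq_zero_iff (ε : P R k ≃ₐ[T] P R k) (Q : Classes X → Classes X → Prop)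
    (f : IncidenceAlgebra R X) :
    (∀ s t, Q (cls s) (cls t) → blockAut hk ν ε f s t = 0) ↔
      ∀ s t, Q (cls s) (cls t) → f s t = 0 := by
  have key : ∀ (δ : P R k ≃ₐ[T] P R k) (g : IncidenceAlgebra R X),
      (∀ s t, Q (cls s) (cls t) → g s t = 0) →
        ∀ s t, Q (cls s) (cls t) → blockAut hk ν δ g s t = 0 := by
    intro δ g h s t hst
    have h0 : block hk ν g s t = 0 := by
      ext i j
      exact h _ _ (by rwa [cls_elt, cls_elt])
    rw [← block_pos hk ν, block_blockAut, h0, map_zero]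
    rfl
  refine ⟨fun h => ?_, key ε f⟩
  have := key ε⁻¹ _ h
  rwa [← AlgEquiv.mul_apply, ← map_mul, inv_mul_cancel, map_one] at this

theorem blockAut_mem_C (ε : P R k ≃ₐ[T] P R k) : blockAut hk ν ε ∈ C T R X := by
  refine ⟨⟨fun f => ?_, fun f => ?_⟩, fun x f => ?_⟩
  · rw [mem_L, mem_L]
    exact blockAut_apply_eq_zero_iff hk ν ε (fun c d => c ≠ d) f
  · rw [mem_M_iff_cls, mem_M_iff_cls]
    exact blockAut_apply_eq_zero_iff hk ν ε (fun c d => c = d) f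
  · exact blockAut_apply_eq_zero_iff hk ν ε (fun c d => ¬ (c = cls x ∧ d = cls x)) f

end BlockElements

end IncAlg
namespace IncAlg

/-! ### The local block automorphisms agree in `Out P`, and `α` is globally inner times block -/

section Restriction

variable {T R X : Type*} [CommRing T] [Ring R] [Algebra T R]
  [Preorder X] [LocallyFiniteOrder X] [DecidableEq X]
  {k : ℕ} (hk : ∀ c : Classes X, k ∣ size c) (ν : Numbering X)

/-- `α` restricts to a bijection of `R_x`, and a surjective multiplicative map preserves the
identity: apply `α` to `e_x a = a`, where `α a = e_x`. -/
theorem Omega1_map_e {α : AutL T R X} (hα : α ∈ Omega1 T R X) (x : X) :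
    (α ⟨e R x, Rx_le_L (e_mem_Rx x)⟩ : IncidenceAlgebra R X) = e R x := by
  set E : L T R X := ⟨e R x, Rx_le_L (e_mem_Rx x)⟩ with hE
  obtain ⟨a, ha⟩ := α.surjective E
  have haR : (a : IncidenceAlgebra R X) ∈ Rx T R x := by
    rw [← hα.2, ha]
    exact e_mem_Rx x
  have hEa : E * a = a := Subtype.ext (e_mul_of_mem haR)
  have h1 : α E * E = E := by
    have h := map_mul α E a
    rw [hEa, ha] at h
    exact h.symm
  have h2 : (α E : IncidenceAlgebra R X) ∈ Rx T R x := (hα.2 x E).2 (e_mem_Rx x)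
  rw [← mul_e_of_mem h2]
  exact congrArg Subtype.val h1

/-- `α` restricts on `R_x` to the product of the inner automorphism `b ↦ u b v` and the block
automorphism defined by `ε`. -/
structure IsInnerMulBlock (α : AutL T R X) (x : X) (u v : IncidenceAlgebra R X)
    (ε : P R k ≃ₐ[T] P R k) : Prop where
  left_mem : u ∈ Rx T R x
  right_mem : v ∈ Rx T R x
  left_mul_right : u * v = e R x
  right_mul_left : v * u = e R x
  map_eq : ∀ a : L T R X, (a : IncidenceAlgebra R X) ∈ Rx T R x →
    (α a : IncidenceAlgebra R X) = u * blockAut hk ν ε (a : IncidenceAlgebra R X) * v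

variable {hk ν}

theorem IsInnerMulBlock.exists_map_singleBlock {φ : AutK T R X} {α : AutL T R X}
    (hφα : IsEntryL φ α) {x : X} {u v : IncidenceAlgebra R X} {ε : P R k ≃ₐ[T] P R k}
    (h : IsInnerMulBlock hk ν α x u v ε) (p : P R k) :
    ∃ μ ∈ M R X, φ (singleBlock hk ν x x p) = u * singleBlock hk ν x x (ε p) * v + μ := by
  have hp : singleBlock hk ν x x p ∈ Rx T R x := singleBlock_mem_Rx hk ν x p
  refine ⟨_, hφα ⟨_, Rx_le_L hp⟩, ?_⟩
  rw [h.map_eq _ hp, blockAut_singleBlock hk ν ε le_rfl, add_sub_cancel]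

/-- `φ` induces a semilinear map on the block of `(x, y)` if `[y]` covers `[x]`. -/
theorem block_semilinear {φ : AutK T R X} (hφ : IsTriangular φ) {α : AutL T R X}
    (hφα : IsEntryL φ α) {x y : X}
    (hcov : ∀ z, x ≤ z → z ≤ y → z ≤ x ∨ y ≤ z)
    {u v u' v' : IncidenceAlgebra R X} {ε δ : P R k ≃ₐ[T] P R k}
    (hx : IsInnerMulBlock hk ν α x u v ε) (hy : IsInnerMulBlock hk ν α y u' v' δ)
    {m : IncidenceAlgebra R X} (hm : m ∈ M R X) (a b : P R k) :
    block hk ν (v * φ (singleBlock hk ν x x a * m * singleBlock hk ν y y b) * u') x y =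
      ε a * block hk ν (v * φ m * u') x y * δ b := by
  obtain ⟨μ, hμ, hA⟩ := hx.exists_map_singleBlock hφα a
  obtain ⟨μ', hμ', hB⟩ := hy.exists_map_singleBlock hφα b
  have hφm : φ m ∈ M R X := (hφ m).2 hm
  set A := singleBlock hk ν x x (ε a) with hAdef
  set B := singleBlock hk ν y y (δ b) with hBdef
  have hAmem : A ∈ Rx T R x := singleBlock_mem_Rx hk ν x _
  have hBmem : B ∈ Rx T R y := singleBlock_mem_Rx hk ν y _
  -- The error terms `μ`, `μ'` and also `φ m` lie in `M`, so each error contributes a product of two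
  -- elements of `M`, which vanishes between `e_x` and `e_y`.
  have h1 : e R x * (μ * (φ m * φ (singleBlock hk ν y y b))) * e R y = 0 :=
    e_mul_mul_mul_e_eq_zero hcov hμ ((M R X).mul_mem_right _ _ hφm)
  have h2 : e R x * ((u * A * v * φ m) * μ') * e R y = 0 :=
    e_mul_mul_mul_e_eq_zero hcov ((M R X).mul_mem_left _ _ hφm) hμ'
  have h3 : v * φ (singleBlock hk ν x x a * m * singleBlock hk ν y y b) * u' =
      A * (v * φ m * u') * B := by
    have hz : ∀ f, e R x * f * e R y = 0 → v * f * u' = 0 := fun f hf => by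
      rw [← mul_e_of_mem hx.right_mem, ← e_mul_of_mem hy.left_mem, ← mul_assoc,
        mul_assoc v, mul_assoc v, hf, mul_zero, zero_mul]
    have h4 := hz _ h1
    have h5 := hz _ h2
    calc v * φ (singleBlock hk ν x x a * m * singleBlock hk ν y y b) * u'
        = v * ((u * A * v + μ) * φ m * φ (singleBlock hk ν y y b)) * u' := by
          rw [map_mul, map_mul, hA]
      _ = v * (μ * (φ m * φ (singleBlock hk ν y y b))) * u' +
          v * (u * A * v * φ m * φ (singleBlock hk ν y y b)) * u' := by noncomm_ring
      _ = v * (u * A * v * φ m * (u' * B * v')) * u' +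
          v * ((u * A * v * φ m) * μ') * u' := by
          rw [h4, hB]
          noncomm_ring
      _ = (v * u) * A * (v * φ m * u') * (B * (v' * u')) := by
          rw [h5, add_zero]
          noncomm_ring
      _ = A * (v * φ m * u') * B := by
          rw [hx.right_mul_left, hy.right_mul_left, e_mul_of_mem hAmem, mul_e_of_mem hBmem]
  rw [h3, block_mul_singleBlock, block_singleBlock_mul]

theorem block_e_mul_mul_e (f : IncidenceAlgebra R X) (x y : X) :
    block hk ν (e R x * f * e R y) x y = block hk ν f x y := by
  ext i j
  change (e R x * f * e R y : IncidenceAlgebra R X) (elt hk ν x i) (elt hk ν y j) =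
    f (elt hk ν x i) (elt hk ν y j)
  rw [mul_e_apply, e_mul_apply, if_pos (cls_elt ..), if_pos (cls_elt ..)]

/-- Semilinearity gives `ε a · τ 1 = τ a = τ 1 · δ a`. Once `τ` takes the value `1`, the element `τ
1` is invertible, and `ε` is `δ` followed by conjugation by it. -/
theorem mk_eq_mk_of_covers {φ : AutK T R X} (hφ : IsTriangular φ) {α : AutL T R X}
    (hφα : IsEntryL φ α) {x y : X} (hxy : x ≤ y) (hyx : ¬ y ≤ x)
    (hcov : ∀ z, x ≤ z → z ≤ y → z ≤ x ∨ y ≤ z)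
    {u v u' v' : IncidenceAlgebra R X} {ε δ : P R k ≃ₐ[T] P R k}
    (hx : IsInnerMulBlock hk ν α x u v ε) (hy : IsInnerMulBlock hk ν α y u' v' δ) :
    (ε : Out T (P R k)) = δ := by
  have key := fun (m : IncidenceAlgebra R X) (hm : m ∈ M R X) (a b : P R k) =>
    block_semilinear hφ hφα hcov hx hy hm a b
  simp only [singleBlock_mul_mul_singleBlock hk ν hxy] at key
  set τ : P R k → P R k := fun p => block hk ν (v * φ (singleBlock hk ν x y p) * u') x y with hτ
  have hblock : ∀ p : P R k, block hk ν (singleBlock hk ν x y p) x y = p := fun p => by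
    rw [block_singleBlock hk ν hxy, if_pos ⟨rfl, rfl⟩]
  have hleft : ∀ a, τ a = ε a * τ 1 := fun a => by
    have := key _ (singleBlock_mem_M hk ν hxy hyx 1) a 1
    rwa [hblock, mul_one, mul_one, map_one, mul_one] at this
  have hright : ∀ a, τ a = τ 1 * δ a := fun a => by
    have := key _ (singleBlock_mem_M hk ν hxy hyx 1) 1 a
    rwa [hblock, mul_one, one_mul, map_one, one_mul] at this
  obtain ⟨a, ha⟩ : ∃ a, τ a = 1 := by
    -- The element `s` is chosen so that `v * s * u'` has block `1` at `(x, y)`. With `a = b = 1`,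
    -- `key` says that only the `(x, y)` block of an element of `M` matters, so that block of `φ⁻¹
    -- s` is a preimage of `1`.
    set s := u * singleBlock hk ν x y 1 * v' with hs
    have hsM : φ.symm s ∈ M R X := by
      rw [← hφ, φ.apply_symm_apply]
      exact (M R X).mul_mem_right _ _
        ((M R X).mul_mem_left _ _ (singleBlock_mem_M hk ν hxy hyx 1))
    refine ⟨block hk ν (φ.symm s) x y, ?_⟩
    have := key _ hsM 1 1
    rw [mul_one, one_mul, map_one, map_one, one_mul, mul_one, φ.apply_symm_apply] at this
    refine this.trans ?_
    have h1 : v * s * u' = e R x * singleBlock hk ν x y 1 * e R y := by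
      rw [← hx.right_mul_left, ← hy.right_mul_left, hs]
      noncomm_ring
    rw [h1, block_e_mul_mul_e, hblock]
  have h1 : τ 1 * δ a = 1 := by rw [← hright, ha]
  have h2 : ε a * τ 1 = 1 := by rw [← hleft, ha]
  have h3 : δ a = ε a := (left_inv_eq_right_inv h2 h1).symm
  let w : (P R k)ˣ := ⟨τ 1, δ a, h1, by rw [h3, h2]⟩
  rw [QuotientGroup.eq_iff_div_mem]
  refine ⟨w, ?_⟩
  rw [eq_div_iff_mul_eq']
  ext1 p
  change τ 1 * δ p * δ a = ε p
  rw [← hright, hleft, mul_assoc, h1, mul_one]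

/-- A function on the classes that takes the same value at every class and the classes covering
it takes the same value at any two comparable classes. -/
theorem eq_of_le_of_forall_covers {S : Type*} (F : Classes X → S) (g : Classes X → X)
    (hg : ∀ c, cls (g c) = c)
    (hF : ∀ c d, c < d → (∀ z, g c ≤ z → z ≤ g d → z ≤ g c ∨ g d ≤ z) → F c = F d) :
    ∀ c d, c ≤ d → F c = F d := by
  have hle : ∀ c d, c ≤ d ↔ g c ≤ g d := fun c d => by
    conv_lhs => rw [← hg c, ← hg d]
    exact toAntisymmetrization_le_toAntisymmetrization_iff
  -- Strong induction on the size of the interval between representatives. An intermediate `z` is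
  -- replaced by the representative of its class, which splits the interval into two strictly
  -- smaller ones.
  suffices H : ∀ n c d, (Finset.Icc (g c) (g d)).card = n → c ≤ d → F c = F d from
    fun c d => H _ c d rfl
  intro n
  induction n using Nat.strong_induction_on with
  | _ n ih =>
    intro c d hn hcd
    rcases hcd.eq_or_lt with rfl | hlt
    · rfl
    by_cases hcov : ∀ z, g c ≤ z → z ≤ g d → z ≤ g c ∨ g d ≤ z
    · exact hF c d hlt hcov
    push Not at hcov
    obtain ⟨z, h1, h2, h3, h4⟩ := hcov
    have hz := cls_eq_iff.1 (hg (cls z))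
    have hcz : g c ≤ g (cls z) := h1.trans hz.2
    have hzd : g (cls z) ≤ g d := hz.1.trans h2
    have hgcd := hcz.trans hzd
    have hlt1 : (Finset.Icc (g c) (g (cls z))).card < n := by
      rw [← hn]
      refine Finset.card_lt_card ((Finset.Icc_subset_Icc_right hzd).ssubset_of_mem_notMem
        (Finset.mem_Icc.2 ⟨hgcd, le_rfl⟩) fun h => ?_)
      exact h4 ((Finset.mem_Icc.1 h).2.trans hz.1)
    have hlt2 : (Finset.Icc (g (cls z)) (g d)).card < n := by
      rw [← hn]
      refine Finset.card_lt_card ((Finset.Icc_subset_Icc_left hcz).ssubset_of_mem_notMem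
        (Finset.mem_Icc.2 ⟨le_rfl, hgcd⟩) fun h => ?_)
      exact h3 (hz.2.trans (Finset.mem_Icc.1 h).1)
    exact (ih _ hlt1 c (cls z) rfl ((hle _ _).2 hcz)).trans
      (ih _ hlt2 (cls z) d rfl ((hle _ _).2 hzd))

theorem eq_of_isConnected (hX : IsConnected X) {S : Type*} (F : Classes X → S)
    (hF : ∀ c d, c ≤ d → F c = F d) (c d : Classes X) : F c = F d := by
  obtain ⟨p⟩ := hX.preconnected c d
  induction p with
  | nil => rfl
  | cons h _ ih =>
    refine Eq.trans ?_ ih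
    rcases (SimpleGraph.fromRel_adj _ _ _).1 h with ⟨_, h | h⟩
    · exact hF _ _ h
    · exact (hF _ _ h).symm

variable (hk ν)

/-- All `ε c` have the same image in `Out P`, so each is `ε c₀` up to conjugation by a unit `w c` of
`P`. Since `L` is the product of the `R_x`, the local conjugating units combine into one. -/
theorem exists_blockAut_conj (hX : IsConnected X) (hstar : ConditionStar T R hk ν)
    {α : AutL T R X} (hα : α ∈ Omega1 T R X) :
    ∃ (u : (L T R X)ˣ) (ε : P R k ≃ₐ[T] P R k), ∀ a : L T R X,
      (α a : IncidenceAlgebra R X) =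
        (u : L T R X) * blockAut hk ν ε (a : IncidenceAlgebra R X) * (↑u⁻¹ : L T R X) := by
  have hstar' : ∀ x, ∃ u v ε, IsInnerMulBlock hk ν α x u v ε := fun x => by
    obtain ⟨u, hu, v, hv, huv, hvu, ε, hε⟩ := hstar α hα x
    exact ⟨u, v, ε, hu, hv, huv, hvu, hε⟩
  let g : Classes X → X := fun c => ofAntisymmetrization (· ≤ ·) c
  have hg : ∀ c, cls (g c) = c := fun c => toAntisymmetrization_ofAntisymmetrization _ c
  choose u v ε h using fun c => hstar' (g c)
  obtain ⟨φ, hφ, hφα⟩ := hα.1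
  have hconst : ∀ c d, (ε c : Out T (P R k)) = ε d := by
    refine eq_of_isConnected hX _ (eq_of_le_of_forall_covers _ g hg fun c d hcd hcov => ?_)
    rw [← hg c, ← hg d, toAntisymmetrization_lt_toAntisymmetrization_iff] at hcd
    exact mk_eq_mk_of_covers hφ hφα hcd.le hcd.not_ge hcov (h c) (h d)
  obtain ⟨c₀⟩ := hX.nonempty
  have hw : ∀ c, ∃ w : (P R k)ˣ, conjAut T _ w = ε c / ε c₀ := fun c =>
    (QuotientGroup.eq_iff_div_mem).1 (hconst c c₀)
  choose w hw using hw
  have hε : ∀ c f, blockAut hk ν (ε c) f =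
      scalarBlock hk ν (w c : P R k) * blockAut hk ν (ε c₀) f *
        scalarBlock hk ν (↑(w c)⁻¹ : P R k) := fun c f => by
    rw [← blockAut_conjAut (T := T), hw, ← AlgEquiv.mul_apply, ← map_mul, div_mul_cancel]
  -- The correction `w c` enters as a scalar block matrix. It lies in `L` and so commutes with the
  -- idempotents, which keeps `U c` and `V c` in `R_x` and mutually inverse there.
  let U : Classes X → IncidenceAlgebra R X := fun c => u c * scalarBlock hk ν (w c : P R k)
  let V : Classes X → IncidenceAlgebra R X := fun c => scalarBlock hk ν (↑(w c)⁻¹ : P R k) * v c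
  have hcongr : ∀ x : X, cls (g (cls x)) = cls x := fun x => hg _
  have hU : ∀ x : X, U (cls x) ∈ Rx T R x := fun x => by
    rw [← Rx_congr (hcongr x)]
    have := e_mul_mul_e_mem (T := T) (g (cls x)) (U (cls x))
    rwa [mul_assoc, mul_assoc, ← e_mul_comm_of_mem_L (T := T) (scalarBlock_mem_L hk ν _),
      ← mul_assoc (u _), mul_e_of_mem (h _).left_mem, ← mul_assoc,
      e_mul_of_mem (h _).left_mem] at this
  have hV : ∀ x : X, V (cls x) ∈ Rx T R x := fun x => by
    rw [← Rx_congr (hcongr x)]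
    have := e_mul_mul_e_mem (T := T) (g (cls x)) (V (cls x))
    rwa [← mul_assoc, e_mul_comm_of_mem_L (T := T) (scalarBlock_mem_L hk ν _), mul_assoc,
      mul_assoc, mul_e_of_mem (h _).right_mem, e_mul_of_mem (h _).right_mem] at this
  have hww : ∀ c, scalarBlock hk ν (w c : P R k) * scalarBlock hk ν (↑(w c)⁻¹ : P R k) = 1 :=
    fun c => by rw [← scalarBlock_mul, Units.mul_inv, scalarBlock_one]
  have hww' : ∀ c, scalarBlock hk ν (↑(w c)⁻¹ : P R k) * scalarBlock hk ν (w c : P R k) = 1 :=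
    fun c => by rw [← scalarBlock_mul, Units.inv_mul, scalarBlock_one]
  have hUV : ∀ x : X, U (cls x) * V (cls x) = e R x := fun x => by
    rw [← e_congr (hcongr x), ← (h _).left_mul_right]
    change _ * _ * (_ * _) = _
    rw [mul_assoc, ← mul_assoc (scalarBlock hk ν _), hww, one_mul]
  have hVU : ∀ x : X, V (cls x) * U (cls x) = e R x := fun x => by
    change _ * _ * (_ * _) = _
    rw [mul_assoc, ← mul_assoc (v _), (h _).right_mul_left,
      e_mul_comm_of_mem_L (T := T) (scalarBlock_mem_L hk ν _), ← mul_assoc, hww', one_mul,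
      e_congr (hcongr x)]
  let w' : (L T R X)ˣ := ⟨⟨glue U, glue_mem_L hU⟩, ⟨glue V, glue_mem_L hV⟩,
    Subtype.ext (glue_mul_glue hU hV hUV), Subtype.ext (glue_mul_glue hV hU hVU)⟩
  refine ⟨w', ε c₀, fun a => ?_⟩
  change _ = glue U * blockAut hk ν (ε c₀) (a : IncidenceAlgebra R X) * glue V
  have hbL : ∀ δ : P R k ≃ₐ[T] P R k,
      blockAut hk ν δ (a : IncidenceAlgebra R X) ∈ L T R X := fun δ =>
    ((blockAut_mem_C hk ν _).1.1 _).2 a.2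
  ext s t _
  by_cases hst : cls s = cls t
  · rw [mul_glue_apply hV, mul_assoc, glue_mul_apply, ← mul_assoc, ← hst]
    -- For `s ∼ t` the entry of `α a` at `(s, t)` depends only on `e_s a e_s ∈ R_s`, where the local
    -- form of `α` applies.
    set E : L T R X := ⟨e R s, Rx_le_L (e_mem_Rx s)⟩ with hE
    have hEa : (E * a * E : L T R X) ∈ {b : L T R X | (b : IncidenceAlgebra R X) ∈ Rx T R s} :=
      e_mul_mul_e_mem (T := T) s (a : IncidenceAlgebra R X)
    have h1 : (α (E * a * E) : IncidenceAlgebra R X) = e R s * α a * e R s := by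
      rw [map_mul, map_mul]
      change (α E : IncidenceAlgebra R X) * α a * α E = _
      rw [Omega1_map_e hα]
    have h2 : (α a : IncidenceAlgebra R X) s t = (α (E * a * E) : IncidenceAlgebra R X) s t := by
      rw [h1, mul_e_apply, e_mul_apply, if_pos hst.symm, if_pos rfl]
    have hEblock : blockAut hk ν (ε (cls s)) (e R s) = e R s := by
      have h3 := blockAut_mem_C (T := T) (R := R) hk ν (ε (cls s))
      have h4 : blockAut hk ν (ε (cls s)) (e R s) ∈ Rx T R s := (h3.2 s _).2 (e_mem_Rx s)
      obtain ⟨b, hb⟩ := (blockAut hk ν (ε (cls s))).surjective (e R s)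
      have hbR : b ∈ Rx T R s := by
        rw [← h3.2, hb]
        exact e_mem_Rx s
      rw [← mul_e_of_mem h4]
      nth_rw 2 [← hb]
      rw [← map_mul, e_mul_of_mem hbR, hb]
    rw [h2, (h (cls s)).map_eq _ (by rw [Rx_congr (hcongr s)]; exact hEa)]
    change (u (cls s) * blockAut hk ν (ε (cls s)) (e R s * (a : IncidenceAlgebra R X) * e R s)
      * v (cls s)) s t = _
    rw [map_mul, map_mul, hEblock, ← e_congr (hcongr s)]
    have h5 : ∀ b, u (cls s) * (e R (g (cls s)) * b * e R (g (cls s))) * v (cls s) =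
        u (cls s) * b * v (cls s) := fun b => by
      rw [← mul_assoc, ← mul_assoc, mul_e_of_mem (h _).left_mem, mul_assoc (_ * b),
        e_mul_of_mem (h _).right_mem]
    rw [h5, hε]
    simp only [U, V, mul_assoc]
  · rw [mem_L.1 (α a).2 s t hst]
    exact (mem_L.1 (mul_mem (mul_mem (glue_mem_L (T := T) hU) (hbL _)) (glue_mem_L hV)) s t
      hst).symm

end Restriction

end IncAlg
namespace IncAlg

/-! ### Restriction from `C` to `Ω₁`, its kernel `Ψ`, and conjugation by units of `L` -/

section OuterGroups

variable {T R X : Type*} [CommRing T] [Ring R] [Algebra T R]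
  [Preorder X] [LocallyFiniteOrder X] [DecidableEq X]

theorem conjAut_mem_C (u : (L T R X)ˣ) :
    conjAut T (IncidenceAlgebra R X) (Units.map (L T R X).val.toMonoidHom u) ∈ C T R X := by
  have key : ∀ (v : (L T R X)ˣ) (f : IncidenceAlgebra R X),
      (f ∈ L T R X →
        conjAut T (IncidenceAlgebra R X) (Units.map (L T R X).val.toMonoidHom v) f ∈ L T R X) ∧
      (f ∈ M R X →
        conjAut T (IncidenceAlgebra R X) (Units.map (L T R X).val.toMonoidHom v) f ∈ M R X) ∧
      ∀ x, f ∈ Rx T R x →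
        conjAut T (IncidenceAlgebra R X) (Units.map (L T R X).val.toMonoidHom v) f ∈ Rx T R x := by
    intro v f
    change (_ → (v : L T R X) * f * (↑v⁻¹ : L T R X) ∈ _) ∧
      (_ → (v : L T R X) * f * (↑v⁻¹ : L T R X) ∈ _) ∧
      ∀ x, _ → (v : L T R X) * f * (↑v⁻¹ : L T R X) ∈ _
    refine ⟨fun hf => mul_mem (mul_mem (v : L T R X).2 hf) (↑v⁻¹ : L T R X).2,
      fun hf => (M R X).mul_mem_right _ _ ((M R X).mul_mem_left _ _ hf), fun x hf => ?_⟩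
    -- Units of `L` commute with `e_x`, so conjugation by them maps `e_x K e_x` into itself.
    have h := e_mul_mul_e_mem (T := T) (R := R) x ((v : L T R X) * f * (↑v⁻¹ : L T R X))
    have h1 : e R x * ((v : L T R X) * f * (↑v⁻¹ : L T R X)) * e R x =
        (v : L T R X) * (e R x * f * e R x) * (↑v⁻¹ : L T R X) :=
      calc _ = e R x * (v : L T R X) * f * ((↑v⁻¹ : L T R X) * e R x) := by
            simp only [mul_assoc]
        _ = _ := by
            rw [e_mul_comm_of_mem_L (v : L T R X).2, ← e_mul_comm_of_mem_L (↑v⁻¹ : L T R X).2]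
            simp only [mul_assoc]
    rwa [h1, e_mul_of_mem hf, mul_e_of_mem hf] at h
  -- The converse implications follow from `key` for the inverse unit.
  have hinv : ∀ f, conjAut T (IncidenceAlgebra R X) (Units.map (L T R X).val.toMonoidHom u⁻¹)
      (conjAut T (IncidenceAlgebra R X) (Units.map (L T R X).val.toMonoidHom u) f) = f := by
    intro f
    rw [← AlgEquiv.mul_apply, ← map_mul, ← map_mul, inv_mul_cancel, map_one, map_one]
    rfl
  refine ⟨⟨fun f => ⟨fun h => ?_, (key u f).1⟩, fun f => ⟨fun h => ?_, (key u f).2.1⟩⟩,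
    fun x f => ⟨fun h => ?_, (key u f).2.2 x⟩⟩
  · have := (key u⁻¹ _).1 h
    rwa [hinv] at this
  · have := (key u⁻¹ _).2.1 h
    rwa [hinv] at this
  · have := (key u⁻¹ _).2.2 x h
    rwa [hinv] at this

variable (T R X) in
theorem Inn0_le_C : Inn0 T R X ≤ C T R X := by
  rintro _ ⟨u, rfl⟩
  exact conjAut_mem_C u

variable (T R X) in
theorem Psi_le_C : Psi T R X ≤ C T R X := fun φ hφ => by
  refine ⟨hφ.1, fun x f => ⟨fun h => ?_, fun h => ?_⟩⟩
  · have h1 : f ∈ L T R X := (hφ.1.1 f).1 (Rx_le_L h)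
    rwa [hφ.2 f h1] at h
  · rwa [hφ.2 f (Rx_le_L h)]

/-- Restriction of the elements of `C` to automorphisms of `L`. -/
def restrictL (φ : C T R X) : AutL T R X where
  toFun a := ⟨φ.1 a, (φ.2.1.1 a).2 a.2⟩
  invFun a := ⟨φ.1.symm a, (φ.2.1.1 _).1 (by rw [φ.1.apply_symm_apply]; exact a.2)⟩
  left_inv a := Subtype.ext (φ.1.symm_apply_apply _)
  right_inv a := Subtype.ext (φ.1.apply_symm_apply _)
  map_mul' a b := Subtype.ext (map_mul φ.1 _ _)
  map_add' a b := Subtype.ext (map_add φ.1 _ _)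
  commutes' t := Subtype.ext (φ.1.commutes t)

theorem coe_restrictL (φ : C T R X) (a : L T R X) :
    (restrictL φ a : IncidenceAlgebra R X) = φ.1 a := rfl

variable (T R X) in
/-- Restriction to `L` as a homomorphism `C → Ω₁`. -/
def restrictHom : C T R X →* Omega1 T R X where
  toFun φ := ⟨restrictL φ, ⟨φ.1, φ.2.1.2, fun a => by
    rw [coe_restrictL, sub_self]
    exact (M R X).zero_mem⟩, fun x a => φ.2.2 x a⟩
  map_one' := rfl
  map_mul' _ _ := rfl

theorem coe_restrictHom_apply (φ : C T R X) (a : L T R X) :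
    ((restrictHom T R X φ : AutL T R X) a : IncidenceAlgebra R X) = φ.1 a := rfl

/-- Conjugation by units of `L` as a homomorphism to `C`. -/
def conjC : (L T R X)ˣ →* C T R X :=
  ((conjAut T (IncidenceAlgebra R X)).comp
    (Units.map (L T R X).val.toMonoidHom)).codRestrict _ conjAut_mem_C

theorem restrictHom_conjC (u : (L T R X)ˣ) :
    (restrictHom T R X (conjC u) : AutL T R X) = conjAut T (L T R X) u := rfl

variable (T R X) in
theorem Inn_le_Omega1 : Inn T (L T R X) ≤ Omega1 T R X := by
  rintro _ ⟨u, rfl⟩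
  rw [← restrictHom_conjC]
  exact (restrictHom T R X (conjC u)).2

theorem mem_Psi_of_restrictHom_eq_one {φ : C T R X} (h : restrictHom T R X φ = 1) :
    φ.1 ∈ Psi T R X := by
  refine ⟨φ.2.1, fun f hf => ?_⟩
  rw [← coe_restrictHom_apply φ ⟨f, hf⟩, h]
  rfl

theorem restrictHom_eq_one_of_mem_Psi {φ : C T R X} (h : φ.1 ∈ Psi T R X) :
    restrictHom T R X φ = 1 :=
  Subtype.ext (AlgEquiv.ext fun a => Subtype.ext (h.2 a a.2))

/-- Conjugation by `u` is trivial on `L` exactly when `u` commutes with all of `L`. This identifies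
`Ψ ∩ In₀(Aut K)` with `Ψ₀`. -/
theorem conjC_mem_Psi_iff (u : (L T R X)ˣ) :
    (conjC u : AutK T R X) ∈ Psi T R X ↔ u ∈ (Submonoid.center (L T R X)).units := by
  have h1 : (conjC u : AutK T R X) ∈ Psi T R X ↔ ∀ a : L T R X, ↑u * a = a * ↑u := by
    constructor
    · intro h a
      have h2 := congrArg Subtype.val (restrictHom_eq_one_of_mem_Psi h)
      rw [restrictHom_conjC] at h2
      have h3 : (u : L T R X) * a * (↑u⁻¹ : L T R X) = a := DFunLike.congr_fun h2 a
      rwa [Units.mul_inv_eq_iff_eq_mul] at h3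
    · intro h
      refine mem_Psi_of_restrictHom_eq_one (Subtype.ext (AlgEquiv.ext fun a => ?_))
      rw [restrictHom_conjC]
      change (u : L T R X) * a * (↑u⁻¹ : L T R X) = a
      rw [Units.mul_inv_eq_iff_eq_mul, h]
  rw [h1, Submonoid.mem_units_iff]
  constructor
  · refine fun h => ⟨Submonoid.mem_center_iff.2 fun a => (h a).symm,
      Submonoid.mem_center_iff.2 fun a => ?_⟩
    rw [Units.eq_inv_mul_iff_mul_eq, ← mul_assoc, h, mul_assoc, Units.mul_inv, mul_one]
  · exact fun h a => (Submonoid.mem_center_iff.1 h.1 a).symm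

/-! ### Product decompositions and the isomorphisms with `Out P` -/

section Block

variable {k : ℕ} (hk : ∀ c : Classes X, k ∣ size c) (ν : Numbering X)

variable (T R) in
/-- The block automorphism of `K` defined by `ε`, as an element of `C`. -/
noncomputable def blockC : (P R k ≃ₐ[T] P R k) →* C T R X :=
  (blockAut hk ν).codRestrict _ (blockAut_mem_C hk ν)

theorem mem_DL_iff {α : AutL T R X} :
    α ∈ DL T R hk ν ↔
      ∃ ε, (restrictHom T R X (blockC T R hk ν ε) : AutL T R X) = α := by
  refine exists_congr fun ε => ⟨fun h => ?_, ?_⟩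
  · exact AlgEquiv.ext fun a => Subtype.ext (h a).symm
  · rintro rfl a
    rfl

/-- Both factors of `α` are defined on all of `K`, so the factorization lifts to `C`; in particular
restriction to `L` maps `C` onto `Ω₁`. -/
theorem exists_eq_conjC_mul_blockC (hX : IsConnected X) (hstar : ConditionStar T R hk ν)
    (α : Omega1 T R X) : ∃ (u : (L T R X)ˣ) (ε : P R k ≃ₐ[T] P R k),
      α = restrictHom T R X (conjC u * blockC T R hk ν ε) := by
  obtain ⟨u, ε, h⟩ := exists_blockAut_conj hk ν hX hstar α.2
  exact ⟨u, ε, Subtype.ext (AlgEquiv.ext fun a => Subtype.ext (h a))⟩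

theorem Omega1_eq (hX : IsConnected X) (hstar : ConditionStar T R hk ν) :
    (Omega1 T R X : Set (AutL T R X)) =
      (Inn T (L T R X) : Set (AutL T R X)) * DL T R hk ν := by
  ext α
  rw [Set.mem_mul]
  constructor
  · intro hα
    obtain ⟨u, ε, h⟩ := exists_eq_conjC_mul_blockC hk ν hX hstar ⟨α, hα⟩
    refine ⟨conjAut T _ u, ⟨u, rfl⟩, _, (mem_DL_iff hk ν).2 ⟨ε, rfl⟩, ?_⟩
    rw [← restrictHom_conjC, ← Subgroup.coe_mul, ← map_mul, ← h]
  · rintro ⟨β, hβ, δ, hδ, rfl⟩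
    obtain ⟨ε, rfl⟩ := (mem_DL_iff hk ν).1 hδ
    exact mul_mem (Inn_le_Omega1 T R X hβ) (restrictHom T R X (blockC T R hk ν ε)).2

theorem C_eq (hX : IsConnected X) (hstar : ConditionStar T R hk ν) :
    (C T R X : Set (AutK T R X)) =
      (Inn0 T R X : Set (AutK T R X)) * Psi T R X * DK T R hk ν := by
  ext φ
  constructor
  · intro hφ
    obtain ⟨u, ε, h⟩ := exists_eq_conjC_mul_blockC hk ν hX hstar (restrictHom T R X ⟨φ, hφ⟩)
    -- Stripping both known factors from `φ` leaves an automorphism that is trivial on `L`: the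
    -- factor in `Ψ`.
    have h1 : restrictHom T R X ((conjC u)⁻¹ * ⟨φ, hφ⟩ * (blockC T R hk ν ε)⁻¹) = 1 := by
      rw [map_mul, map_mul, h, map_mul, map_inv, map_inv]
      group
    have hu : (conjC u : AutK T R X) ∈ Inn0 T R X := ⟨u, rfl⟩
    have hε : blockAut hk ν ε ∈ DK T R hk ν := ⟨ε, rfl⟩
    have h2 := Set.mul_mem_mul (Set.mul_mem_mul hu (mem_Psi_of_restrictHom_eq_one h1)) hε
    convert h2
    change φ = (conjC u : AutK T R X) * ((conjC u : AutK T R X)⁻¹ * φ * (blockAut hk ν ε)⁻¹) *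
      blockAut hk ν ε
    group
  · rintro ⟨_, ⟨β, hβ, ψ, hψ, rfl⟩, _, ⟨ε, rfl⟩, rfl⟩
    exact mul_mem (mul_mem (Inn0_le_C T R X hβ) (Psi_le_C T R X hψ)) (blockAut_mem_C hk ν ε)

/-- A block automorphism of `L` is inner if and only if it is defined by an inner automorphism
of `P`. -/
theorem restrictHom_blockC_mem_Inn_iff [Nonempty X] (ε : P R k ≃ₐ[T] P R k) :
    (restrictHom T R X (blockC T R hk ν ε) : AutL T R X) ∈ Inn T (L T R X) ↔
      ε ∈ Inn T (P R k) := by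
  constructor
  · rintro ⟨u, hu⟩
    obtain ⟨x⟩ := ‹Nonempty X›
    -- The conjugating unit is tested on a single diagonal block, that of `x`; its `(x, x)` block
    -- will conjugate by `ε`.
    have h1 : ∀ p : P R k, (u : L T R X) * singleBlock hk ν x x p =
        singleBlock hk ν x x (ε p) * ((u : L T R X) : IncidenceAlgebra R X) := by
      intro p
      set a : L T R X := ⟨singleBlock hk ν x x p, Rx_le_L (singleBlock_mem_Rx hk ν x p)⟩
      have h2 : (u : L T R X) * a * (↑u⁻¹ : L T R X) =
          (restrictHom T R X (blockC T R hk ν ε) : AutL T R X) a := DFunLike.congr_fun hu a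
      rw [Units.mul_inv_eq_iff_eq_mul] at h2
      have h3 := congrArg Subtype.val h2
      rw [← blockAut_singleBlock hk ν ε le_rfl]
      exact h3
    set U : IncidenceAlgebra R X := ((u : L T R X) : IncidenceAlgebra R X) with hUdef
    set V : IncidenceAlgebra R X := ((↑u⁻¹ : L T R X) : IncidenceAlgebra R X) with hVdef
    have hUV : U * V = 1 := congrArg Subtype.val (Units.mul_inv u)
    have hVU : V * U = 1 := congrArg Subtype.val (Units.inv_mul u)
    have hone : block hk ν (1 : IncidenceAlgebra R X) x x = 1 := by
      rw [← scalarBlock_one hk ν, block_scalarBlock, if_pos rfl]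
    -- For `p = 1`, `h1` says that `U` commutes with the idempotent of this block. Hence `U` has no
    -- other nonzero blocks in its row or column, and its diagonal block is invertible with inverse
    -- the corresponding block of `V`.
    have hrow : ∀ t, elt hk ν t ≠ elt hk ν x → block hk ν U x t = 0 := fun t ht => by
      rw [← one_mul (block hk ν U x t), ← block_singleBlock_mul, ← map_one ε, ← h1,
        block_mul_singleBlock_of_ne hk ν ht]
    have hcol : ∀ s, elt hk ν s ≠ elt hk ν x → block hk ν U s x = 0 := fun s hs => by
      rw [← mul_one (block hk ν U s x), ← block_mul_singleBlock, h1,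
        block_singleBlock_mul_of_ne hk ν hs]
    let w : (P R k)ˣ := ⟨block hk ν U x x, block hk ν V x x, by
        rw [← block_mul_eq_single hk ν (Or.inl rfl) fun t ht => Or.inl (hrow t ht), hUV, hone], by
        rw [← block_mul_eq_single hk ν (Or.inl rfl) fun t ht => Or.inr (hcol t ht), hVU, hone]⟩
    refine ⟨w, AlgEquiv.ext fun p => ?_⟩
    rw [conjAut_apply, Units.mul_inv_eq_iff_eq_mul]
    change block hk ν U x x * p = ε p * block hk ν U x x
    rw [← block_mul_singleBlock, h1, block_singleBlock_mul]
  · rintro ⟨w, rfl⟩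
    let u : (L T R X)ˣ := ⟨⟨_, scalarBlock_mem_L hk ν (w : P R k)⟩,
      ⟨_, scalarBlock_mem_L hk ν (↑w⁻¹ : P R k)⟩,
      Subtype.ext (by
        change scalarBlock hk ν _ * scalarBlock hk ν _ = 1
        rw [← scalarBlock_mul, Units.mul_inv, scalarBlock_one]),
      Subtype.ext (by
        change scalarBlock hk ν _ * scalarBlock hk ν _ = 1
        rw [← scalarBlock_mul, Units.inv_mul, scalarBlock_one])⟩
    exact ⟨u, AlgEquiv.ext fun a => Subtype.ext (blockAut_conjAut hk ν w _).symm⟩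

/-- Sending `ε` to the class of its block automorphism is onto because the inner factor dies in the
quotient, and its kernel consists of the inner `ε`. -/
theorem nonempty_Omega1_quotient_mulEquiv_Out (hX : IsConnected X)
    (hstar : ConditionStar T R hk ν) :
    Nonempty ((Omega1 T R X ⧸ (Inn T (L T R X)).subgroupOf (Omega1 T R X)) ≃*
      Out T (P R k)) := by
  have : Nonempty X := hX.nonempty.map (ofAntisymmetrization (· ≤ ·))
  let f : (P R k ≃ₐ[T] P R k) →*
      (Omega1 T R X ⧸ (Inn T (L T R X)).subgroupOf (Omega1 T R X)) :=
    (QuotientGroup.mk' _).comp ((restrictHom T R X).comp (blockC T R hk ν))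
  have hker : f.ker = Inn T (P R k) := by
    ext ε
    rw [← restrictHom_blockC_mem_Inn_iff hk ν ε, MonoidHom.mem_ker]
    exact (QuotientGroup.eq_one_iff _).trans Subgroup.mem_subgroupOf
  have hsurj : Function.Surjective f := by
    intro q
    obtain ⟨α, rfl⟩ := QuotientGroup.mk_surjective q
    obtain ⟨u, ε, h⟩ := exists_eq_conjC_mul_blockC hk ν hX hstar α
    refine ⟨ε, ?_⟩
    rw [h, map_mul, QuotientGroup.mk_mul, (QuotientGroup.eq_one_iff _).2, one_mul]
    · rfl
    · exact ⟨u, rfl⟩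
  exact ⟨((QuotientGroup.quotientMulEquivOfEq hker.symm).trans
    (QuotientGroup.quotientKerEquivOfSurjective f hsurj)).symm⟩

variable (T R X) in
/-- Restriction to `L`, as a homomorphism `Out₀ K → Ω₁ / In(Aut L)`. -/
def restrictOut :
    Out0 T R X →* Omega1 T R X ⧸ (Inn T (L T R X)).subgroupOf (Omega1 T R X) :=
  QuotientGroup.map _ _ (restrictHom T R X) (by
    rintro ⟨_, _⟩ ⟨u, rfl⟩
    exact ⟨u, rfl⟩)

theorem restrictOut_surjective (hX : IsConnected X) (hstar : ConditionStar T R hk ν) :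
    Function.Surjective (restrictOut T R X) := by
  intro q
  obtain ⟨α, rfl⟩ := QuotientGroup.mk_surjective q
  obtain ⟨u, ε, h⟩ := exists_eq_conjC_mul_blockC hk ν hX hstar α
  exact ⟨QuotientGroup.mk (conjC u * blockC T R hk ν ε), by rw [h]; rfl⟩

-- The map `Ψ → Out₀ K` has kernel `Ψ₀`. Its image is the whole kernel of `restrictOut`: if `φ ∈ C`
-- acts on `L` as conjugation by a unit `u` of `L`, then `φ` times the inverse of that conjugation
-- lies in `Ψ` and has the same class.
variable (T R X) in
theorem nonempty_ker_restrictOut_mulEquiv :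
    Nonempty ((restrictOut T R X).ker ≃*
      (Psi T R X ⧸ (Psi0 T R X).subgroupOf (Psi T R X))) := by
  let g : Psi T R X →* Out0 T R X :=
    (QuotientGroup.mk' _).comp (Subgroup.inclusion (Psi_le_C T R X))
  have hker : g.ker = (Psi0 T R X).subgroupOf (Psi T R X) := by
    ext ψ
    rw [MonoidHom.mem_ker]
    refine (QuotientGroup.eq_one_iff _).trans ?_
    rw [Subgroup.mem_subgroupOf, Subgroup.mem_subgroupOf]
    constructor
    · rintro ⟨u, hu⟩
      refine ⟨u, (conjC_mem_Psi_iff u).1 ?_, hu⟩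
      have hu' : (conjC u : AutK T R X) = ψ := hu
      rw [hu']
      exact ψ.2
    · rintro ⟨u, _, hu⟩
      exact ⟨u, hu⟩
  have hrange : g.range = (restrictOut T R X).ker := by
    ext q
    obtain ⟨φ, rfl⟩ := QuotientGroup.mk_surjective q
    rw [MonoidHom.mem_ker]
    constructor
    · rintro ⟨ψ, hψ⟩
      rw [← hψ]
      change QuotientGroup.mk (restrictHom T R X ⟨ψ, Psi_le_C T R X ψ.2⟩) = _
      rw [restrictHom_eq_one_of_mem_Psi ψ.2, QuotientGroup.mk_one]
    · intro h
      obtain ⟨u, hu⟩ := (QuotientGroup.eq_one_iff (restrictHom T R X φ)).1 h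
      have hu' : restrictHom T R X (conjC u) = restrictHom T R X φ := Subtype.ext hu
      have h1 : restrictHom T R X (φ * (conjC u)⁻¹) = 1 := by
        rw [map_mul, map_inv, hu', mul_inv_cancel]
      refine ⟨⟨_, mem_Psi_of_restrictHom_eq_one h1⟩, ?_⟩
      change QuotientGroup.mk (φ * (conjC u)⁻¹) = _
      have h2 : (QuotientGroup.mk (conjC u)⁻¹ : Out0 T R X) = 1 :=
        (QuotientGroup.eq_one_iff _).2 (inv_mem ⟨u, rfl⟩)
      rw [QuotientGroup.mk_mul, h2, mul_one]
  exact ⟨(MulEquiv.subgroupCongr hrange.symm).trans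
    ((QuotientGroup.quotientKerEquivRange g).symm.trans
      (QuotientGroup.quotientMulEquivOfEq hker))⟩

end Block

end OuterGroups

end IncAlg

/-! ### Conclusion, with `H` the kernel of `restrictOut` -/

theorem theorem8p4 {T R X : Type*} [CommRing T] [Ring R] [Algebra T R]
    [Preorder X] [LocallyFiniteOrder X] [DecidableEq X]
    (hX : IncAlg.IsConnected X)
    (k : ℕ) (hk : ∀ c : IncAlg.Classes X, k ∣ IncAlg.size c) (ν : IncAlg.Numbering X)
    (hII : IncAlg.ConditionII T R X)
    (hstar : IncAlg.ConditionStar T R hk ν) :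
    (IncAlg.Omega1 T R X : Set (IncAlg.AutL T R X)) =
        (Inn T (IncAlg.L T R X) : Set (IncAlg.AutL T R X)) * IncAlg.DL T R hk ν ∧
    Nonempty ((IncAlg.Omega1 T R X ⧸ (Inn T (IncAlg.L T R X)).subgroupOf (IncAlg.Omega1 T R X))
      ≃* Out T (IncAlg.P R k)) ∧
    (IncAlg.C T R X : Set (IncAlg.AutK T R X)) =
        (IncAlg.Inn0 T R X : Set (IncAlg.AutK T R X)) * IncAlg.Psi T R X * IncAlg.DK T R hk ν ∧
    ∃ (H : Subgroup (IncAlg.Out0 T R X)) (_ : H.Normal),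
      Nonempty (H ≃* (IncAlg.Psi T R X ⧸ (IncAlg.Psi0 T R X).subgroupOf (IncAlg.Psi T R X))) ∧
      Nonempty ((IncAlg.Out0 T R X ⧸ H) ≃*
        (IncAlg.Omega1 T R X ⧸ (Inn T (IncAlg.L T R X)).subgroupOf (IncAlg.Omega1 T R X))) ∧
      Nonempty ((IncAlg.Out0 T R X ⧸ H) ≃* Out T (IncAlg.P R k)) := by
  have hOut := IncAlg.nonempty_Omega1_quotient_mulEquiv_Out hk ν hX hstar
  have hquot := QuotientGroup.quotientKerEquivOfSurjective (IncAlg.restrictOut T R X)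
    (IncAlg.restrictOut_surjective hk ν hX hstar)
  exact ⟨IncAlg.Omega1_eq hk ν hX hstar, hOut, IncAlg.C_eq hk ν hX hstar,
    (IncAlg.restrictOut T R X).ker, inferInstance,
    IncAlg.nonempty_ker_restrictOut_mulEquiv T R X, ⟨hquot⟩,
    hOut.map fun f => hquot.trans f⟩
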